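/- Let $q$ be a prime power, $n\ge 1$, $V=\mathbb F_q^{\,n+1}$ (column vectors) and $V^*$ its dual (row vectors). Let $\bar\Gamma$ be the point-hyperplane geometry of $\mathrm{PG}(V)$: its points are the pairs $(p,A)$ with $p$ a point and $A$ a hyperplane of $\mathrm{PG}(V)$ and $p\in A$; two points are collinear if they lie on a common line of the Segre geometry $\mathrm{PG}(V)\otimes\mathrm{PG}(V^*)$. Let $\bar\varepsilon([x],[\xi])=[x\xi]$ be its Segre embedding in the projective space of the trace-zero $(n+1)\times(n+1)$ matrices, and let $\Lambda_1=\{[X_1],\dots,[X_N]\}$ be the image of $\bar\varepsilon$ (the points represented by the matrices of rank $1$ and trace $0$). Let $\mathcal C(\Lambda_1)\subseteq\mathbb F_q^N$ be the code of all words $(\mathfrak m(X_1),\dots,\mathfrak m(X_N))$, where $\mathfrak m$ is a linear functional on matrices; equivalently, of all words $c_M=(\mathrm{Tr}(X_1M),\dots,\mathrm{Tr}(X_NM))$ with $M\in M_{n+1}(q)$. To a word $c$ associate the set $\mathcal H_c$ of the points of $\bar\Gamma$ that $\bar\varepsilon$ maps to points $[X_i]$ with $c_i=0$; thus $\mathcal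 H_{c_M}=\mathcal H_M:=\{([x],[\xi])\in\bar\Gamma:\mathrm{Tr}(x\xi M)=0\}$. For a point $p$ and a hyperplane $A$ of $\mathrm{PG}(V)$, the quasi-singular hyperplane $\mathcal H_{p,A}$ of $\bar\Gamma$ is the set of the points of $\bar\Gamma$ collinear with a point of $\bar\Gamma$ of the form $(p,H)$ or $(x,A)$; it is singular if $p\in A$. A spread-type hyperplane of $\bar\Gamma$ is a set $\{(p,A)\in\bar\Gamma: \ell_p\subseteq A\}$, where $\ell_p$ is the line through $p$ of a line spread $S$ of $\mathrm{PG}(V)$ that admits a dual, i.e. there is a line spread $S^*$ of $\mathrm{PG}(V^*)$ such that, for every $m\in S^*$ (regarded as a subspace of codimension $2$), the members of $S$ contained in $m$ form a line spread of $m$. A hyperplane $\mathcal H$ of $\bar\Gamma$ arises from $\bar\varepsilon$ if $\mathcal H=\bar\varepsilon^{-1}(W)$ for a projective hyperplane $W$ spanned by $\bar\varepsilon(\mathcal H)$. Then the following hold. 1. If $n\ge 2$ and $(n,q)\ne(2,2)$, then $\mathcal C(\Lambda_1)$ is a minimal code: if $c,c'$ are words and $\mathrm{supp}(c')\subseteq\mathrm{supp}(c)$,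 then $c'=\lambda c$ for some $\lambda\in\mathbb F_q$. For all $n\ge1$ the Ashikhmin–Barg condition $w_{\max}/w_{\min}<q/(q-1)$ fails for $\mathcal C(\Lambda_1)$. 2. The minimum weight of the nonzero words is $q^{2n-1}-q^{n-1}$. A word $c$ has this weight if and only if $\mathcal H_c$ is a quasi-singular but non-singular hyperplane of $\bar\Gamma$, and $c\mapsto\mathcal H_c$ induces a bijection from the minimum weight words, up to nonzero scalars, onto these hyperplanes. These words and these hyperplanes are exactly the $c_M$ and the $\mathcal H_M$ with $M$ of rank $1$ and nonzero trace; all such $M$ are diagonalizable. 3. The second lowest weight of the nonzero words is $q^{2n-1}$. A word $c$ has this weight if and only if $\mathcal H_c$ is a singular hyperplane of $\bar\Gamma$, and $c\mapsto\mathcal H_c$ induces a bijection from these words, up to nonzero scalars, onto the singular hyperplanes. These words and these hyperplanes are exactly the $c_M$ and the $\mathcal H_M$ with $M$ of rank $1$ and trace $0$; no such $M$ is diagonalizable. 4. The maximum weight is $q^{n-1}(q^{n+1}-1)/(q-1)$, and $c_M$ has this weight if and only if $M$ has no eigenvalue in $\mathbb F_q$. Every spread-type hyperplane of $\bar\Gamma$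 that arises from $\bar\varepsilon$ is $\mathcal H_c$ for a word $c$ of maximum weight, and every word $c$ such that $\mathcal H_c$ is a spread-type hyperplane has maximum weight. Conversely, if $c_M$ has maximum weight and the minimal polynomial of $M$ has degree $2$, then $\mathcal H_{c_M}$ is a spread-type hyperplane. -/

import Mathlib

namespace PointHyperplaneCode

/-! ### Linear codes and projective systems -/

section Codes

variable {F : Type*} [Field F] {W : Type*} [AddCommGroup W] [Module F W] {N : ℕ}

/-- `X 0, …, X (N-1)` are vector representatives of the points of the set `Ω` of projective
points, each point being represented exactly once. -/
def Represents (Ω : Set (Projectivization F W)) (X : Fin N → W) : Prop :=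
  ∃ h : ∀ i, X i ≠ 0,
    Function.Injective (fun i => Projectivization.mk F (X i) (h i)) ∧
    Set.range (fun i => Projectivization.mk F (X i) (h i)) = Ω

/-- The code `{(m (X 0), …, m (X (N-1))) : m a linear functional}` defined by a system of
vector representatives `X` of a projective system. -/
def projectiveCode (F : Type*) [Field F] {W : Type*} [AddCommGroup W] [Module F W]
    (X : Fin N → W) : Submodule F (Fin N → F) :=
  LinearMap.range (LinearMap.pi fun i => Module.Dual.eval F W (X i))

/-- A code is minimal if every word `c` of it is minimal: each word with support contained in the
support of `c` is a scalar multiple of `c`. -/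
def IsMinimalCode (C : Submodule F (Fin N → F)) : Prop :=
  ∀ c ∈ C, ∀ c' ∈ C, Function.support c' ⊆ Function.support c → ∃ a : F, c' = a • c

/-- The set of the Hamming weights of the nonzero words. -/
def weights [DecidableEq F] (C : Submodule F (Fin N → F)) : Set ℕ :=
  {w | ∃ c ∈ C, c ≠ 0 ∧ hammingNorm c = w}

/-- The Ashikhmin–Barg condition `w_max / w_min < q / (q - 1)`. -/
def AshikhminBarg [Fintype F] [DecidableEq F] (C : Submodule F (Fin N → F)) : Prop :=
  ((sSup (weights C) : ℕ) : ℚ) / ((sInf (weights C) : ℕ) : ℚ) < (Fintype.card F : ℚ) / ((Fintype.card F : ℚ) - 1)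

end Codes

/-! ### The Segre geometry and the point-hyperplane geometry -/

section Geometry

variable (F : Type*) [Field F] (n : ℕ)

/-- `V = F ^ (n + 1)`, column vectors. -/
abbrev Vec : Type _ := Fin (n + 1) → F

/-- The dual of `V`, as row vectors: `ξ` is the functional `x ↦ ξ ⬝ᵥ x`. -/
abbrev CoVec : Type _ := Fin (n + 1) → F

/-- Square matrices of order `n + 1`. -/
abbrev Mat : Type _ := Matrix (Fin (n + 1)) (Fin (n + 1)) F

/-- The points of the Segre geometry `PG(V) ⊗ PG(V*)`: pairs of a point and a hyperplane,
the hyperplane `ker ξ` being the point `[ξ]` of `PG(V*)`. -/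
abbrev SegrePoint : Type _ := Projectivization F (Vec F n) × Projectivization F (CoVec F n)

variable {F n}

/-- The lines of the Segre geometry: `{p} × ℓ` and `ℓ × {A}`, with `ℓ` a line of `PG(V*)`,
respectively of `PG(V)`. -/
def IsSegreLine (L : Set (SegrePoint F n)) : Prop :=
  (∃ (p : Projectivization F (Vec F n)) (U : Submodule F (CoVec F n)),
      Module.finrank F U = 2 ∧ L = {x | x.1 = p ∧ x.2.submodule ≤ U}) ∨
  (∃ (A : Projectivization F (CoVec F n)) (U : Submodule F (Vec F n)),
      Module.finrank F U = 2 ∧ L = {x | x.1.submodule ≤ U ∧ x.2 = A})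

/-- Collinearity: being on a common line. -/
def Collinear (x y : SegrePoint F n) : Prop :=
  ∃ L, IsSegreLine L ∧ x ∈ L ∧ y ∈ L

/-- The point `p` lies in the hyperplane `A`. -/
def Incident (p : Projectivization F (Vec F n)) (A : Projectivization F (CoVec F n)) : Prop :=
  Projectivization.orthogonal A p

variable (F n) in
/-- The point set of the point-hyperplane geometry of `PG(V)`. -/
def flags : Set (SegrePoint F n) := {x | Incident x.1 x.2}

/-- The set `ℋ_{p,A}` of the points of the point-hyperplane geometry that are collinear with a
point of `ℳ_p ∪ ℳ_A`, where `ℳ_p = {(p, H) : p ∈ H}` and `ℳ_A = {(x, A) : x ∈ A}`. -/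
def quasiSingular (p : Projectivization F (Vec F n)) (A : Projectivization F (CoVec F n)) :
    Set (SegrePoint F n) :=
  {x | x ∈ flags F n ∧ ∃ y ∈ flags F n, (y.1 = p ∨ y.2 = A) ∧ Collinear x y}

/-- Quasi-singular hyperplanes of the point-hyperplane geometry. -/
def IsQuasiSingular (H : Set (SegrePoint F n)) : Prop :=
  ∃ p A, H = quasiSingular p A

/-- Singular hyperplanes of the point-hyperplane geometry. -/
def IsSingular (H : Set (SegrePoint F n)) : Prop :=
  ∃ p A, Incident p A ∧ H = quasiSingular p A

/-- `S` is a line spread of the projective space of the subspace `U`. -/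
def IsLineSpread {W : Type*} [AddCommGroup W] [Module F W] (U : Submodule F W)
    (S : Set (Submodule F W)) : Prop :=
  (∀ l ∈ S, Module.finrank F l = 2 ∧ l ≤ U) ∧
  ∀ p : Projectivization F W, p.submodule ≤ U → ∃! l, l ∈ S ∧ p.submodule ≤ l

/-- The subspace of `V` defined by a subspace of the dual. -/
def annihilated (U : Submodule F (CoVec F n)) : Submodule F (Vec F n) where
  carrier := {x | ∀ ξ ∈ U, ξ ⬝ᵥ x = 0}
  add_mem' := fun ha hb ξ hξ => by rw [dotProduct_add, ha ξ hξ, hb ξ hξ, add_zero]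
  zero_mem' := fun ξ _ => dotProduct_zero ξ
  smul_mem' := fun c x hx ξ hξ => by rw [dotProduct_smul, hx ξ hξ, smul_zero]

/-- The line spread `T` of `PG(V*)` is a dual of the line spread `S` of `PG(V)`: for every
member of `T`, seen as a subspace of codimension two of `V`, the members of `S` contained in it
form a line spread of it. -/
def IsDualSpread (S : Set (Submodule F (Vec F n))) (T : Set (Submodule F (CoVec F n))) : Prop :=
  IsLineSpread ⊤ S ∧ IsLineSpread ⊤ T ∧
  ∀ m ∈ T, IsLineSpread (annihilated m) {l | l ∈ S ∧ l ≤ annihilated m}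

/-- Spread-type hyperplanes: `{(p, A) : p ∈ A, ℓ_p ⊆ A}` with `ℓ_p` the line through `p` of a line
spread of `PG(V)` that admits a dual. -/
def IsSpreadType (H : Set (SegrePoint F n)) : Prop :=
  ∃ S T, IsDualSpread S T ∧
    H = {x | x ∈ flags F n ∧ ∃ l ∈ S, x.1.submodule ≤ l ∧ l ≤ annihilated x.2.submodule}

/-! ### The Segre embedding and the code -/

/-- The Segre embedding `([x], [ξ]) ↦ [x ⊗ ξ]`, with `x ⊗ ξ` the column-times-row product. -/
noncomputable def segre (x : SegrePoint F n) : Projectivization F (Mat F n) :=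
  Projectivization.mk F (Matrix.vecMulVec x.1.rep x.2.rep)
    (Matrix.vecMulVec_ne_zero x.1.rep_nonzero x.2.rep_nonzero)

variable (F n) in
/-- `Λ₁`, the image of the point-hyperplane geometry under the Segre embedding. -/
def longRootVariety : Set (Projectivization F (Mat F n)) := segre '' flags F n

variable (F n) in
/-- The space of the matrices of trace zero. -/
def traceZero : Submodule F (Mat F n) :=
  LinearMap.ker (Matrix.traceLinearMap (Fin (n + 1)) F F)

/-- `H` arises from the Segre embedding of the point-hyperplane geometry in the projective space
of the matrices of trace zero: it is the preimage of a projective hyperplane which is spanned by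
the image of `H`. -/
def ArisesFromSegre (H : Set (SegrePoint F n)) : Prop :=
  ∃ W : Submodule F (Mat F n), W ⋖ traceZero F n ∧
    H = {x | x ∈ flags F n ∧ (segre x).submodule ≤ W} ∧
    ⨆ x ∈ H, (segre x).submodule = W

/-- The hyperplane of plain type `ℋ_M`: the preimage of the orthogonal space of `M` with
respect to the form `Tr(XY)`. -/
def plainHyperplane (M : Mat F n) : Set (SegrePoint F n) :=
  {x | x ∈ flags F n ∧ ∀ Y ∈ (segre x).submodule, (Y * M).trace = 0}

/-- The word `(Tr(X₁ M), …, Tr(X_N M))` defined by the matrix `M`. -/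
def codeword {N : ℕ} (X : Fin N → Mat F n) (M : Mat F n) : Fin N → F :=
  fun i => (X i * M).trace

/-- The hyperplane of the point-hyperplane geometry associated to a word `c`: the points which
are mapped by the Segre embedding to a point of the projective system where `c` vanishes. -/
def wordHyperplane {N : ℕ} (X : Fin N → Mat F n) (c : Fin N → F) : Set (SegrePoint F n) :=
  {x | x ∈ flags F n ∧ ∀ i, X i ∈ (segre x).submodule → c i = 0}

/-- `M` is similar over `F` to a diagonal matrix. -/
def IsDiagonalizable (M : Mat F n) : Prop :=
  ∃ (P : GL (Fin (n + 1)) F) (d : Fin (n + 1) → F),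
    M = (P : Mat F n) * Matrix.diagonal d * ((P⁻¹ : GL (Fin (n + 1)) F) : Mat F n)

/-- `M` has no eigenvalue in `F`. -/
def HasNoEigenvalue (M : Mat F n) : Prop :=
  ∀ a : F, ¬ Module.End.HasEigenvalue (Matrix.toLin' M) a

end Geometry

end PointHyperplaneCode

open PointHyperplaneCode

/-! Everything is governed by the set `eigSet M` of the vectors `x` for which `M *ᵥ x` is a multiple
of `x`. Fix `x ≠ 0`. The row vectors `w` with `w ⬝ᵥ x = 0` and `w ⬝ᵥ M *ᵥ x ≠ 0` do not exist if `x`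
is an eigenvector, and otherwise form a subspace of dimension `n` minus one of dimension `n - 1`.
Summing over `x` and dividing out scalars gives `(q - 1) wt(c_M) = q ^ (n - 1) * (q ^ (n + 1) -
|eigSet M|)` (`card_sub_one_mul_ncard_flags_diff`), so low weight means many eigenvectors.

Distinct eigenspaces are independent, so a nonscalar `M` has `q ^ n + q - 1` eigenvectors (zero
included) if it is scalar plus a rank one matrix of nonzero trace, `q ^ n` if it is scalar plus a
rank one matrix of trace zero, and fewer than `q ^ n` in all other cases
(`ncard_eigSet_trichotomy`). Scalar matrices give the zero word, so the two lowest weights come from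
rank one matrices, whose hyperplanes are the quasi-singular ones. The maximum weight means that only
zero is in `eigSet M`; such matrices come from an extension field of degree `n + 1`.

Inclusion of supports means that `M' *ᵥ x` lies in the span of `x` and `M *ᵥ x` for every `x`;
minimality says that then `M'` lies in the span of `1` and `M`
(`exists_eq_add_smul_of_forall_exists`). If it did not, counting the eigenvectors of all `M' - l •
M` would give one with more than `q ^ n`, hence a scalar plus `vecMulVec v w`. This forces `M`
itself to be scalar plus `vecMulVec v w'`, and then the pencil has more eigenvectors than the
trichotomy allows. For rank one `M` and equal hyperplanes a direct argument
(`exists_eq_add_smul_vecMulVec`) works for all `n ≥ 1` and all `q`; it gives the bijections.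

A hyperplane of spread type excludes eigenvectors, since a hyperplane through `x` need not contain
the spread line of `x`. Conversely, if `M` is quadratic without eigenvalues, the lines joining `x`
to `M *ᵥ x` form a spread, and `Mᵀ` provides its dual. -/

namespace PointHyperplaneCode

open Matrix

/-! ### Eigenvectors, rank one matrices and the trace form -/

section LinearAlgebra

variable {F : Type*} [Field F]

/-- A linear map which is pointwise a multiple of another one is a multiple of it. -/
theorem exists_eq_smul_of_forall_exists {U V : Type*} [AddCommGroup U] [Module F U]
    [AddCommGroup V] [Module F V] (f g : U →ₗ[F] V) (h : ∀ u, ∃ a : F, f u = a • g u) :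
    ∃ a : F, f = a • g := by
  by_cases hg : ∃ u, g u ≠ 0
  · obtain ⟨u₀, hu₀⟩ := hg
    obtain ⟨m, hm⟩ := h u₀
    refine ⟨m, LinearMap.ext fun u => ?_⟩
    rw [LinearMap.smul_apply]
    -- If `g u` is proportional to `g u₀`, a difference in the kernel of `g` transfers the factor
    -- `m`; otherwise `g u` and `g u₀` are independent and the sum `u + u₀` forces the factors to
    -- agree.
    by_cases hc : ∃ c : F, g u = c • g u₀
    · obtain ⟨c, hc⟩ := hc
      obtain ⟨b, hb⟩ := h (u - c • u₀)
      rw [map_sub, map_sub, map_smul, map_smul, hc, sub_self, smul_zero, sub_eq_zero, hm] at hb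
      rw [hb, hc, smul_comm]
    · obtain ⟨a, ha⟩ := h u
      obtain ⟨b, hb⟩ := h (u + u₀)
      rw [map_add, map_add, ha, hm] at hb
      have e : (a - b) • g u = (b - m) • g u₀ := by
        rw [sub_smul, sub_smul, sub_eq_sub_iff_add_eq_add, hb, smul_add, add_comm]
      have hab : a - b = 0 := by
        by_contra hne
        exact hc ⟨(a - b)⁻¹ * (b - m), by rw [mul_smul, ← e, smul_smul, inv_mul_cancel₀ hne, one_smul]⟩
      rw [hab, zero_smul, eq_comm, smul_eq_zero, or_iff_left hu₀] at e
      rw [ha, sub_eq_zero.1 hab, sub_eq_zero.1 e]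
  · push Not at hg
    refine ⟨0, LinearMap.ext fun u => ?_⟩
    obtain ⟨a, ha⟩ := h u
    simp [ha, hg]

variable {n : ℕ}

theorem exists_eq_dotProduct (f : (Fin (n + 1) → F) →ₗ[F] F) :
    ∃ w : Fin (n + 1) → F, ∀ x, f x = w ⬝ᵥ x := by
  refine ⟨fun i => f (Pi.single i 1), fun x => ?_⟩
  rw [LinearMap.pi_apply_eq_sum_univ f x, dotProduct]
  refine Finset.sum_congr rfl fun i _ => ?_
  rw [smul_eq_mul, mul_comm]
  congr 2
  ext j
  simp [Pi.single_apply, eq_comm]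

theorem exists_dotProduct_ne_zero {U : Submodule F (Fin (n + 1) → F)} {y : Fin (n + 1) → F}
    (hy : y ∉ U) : ∃ w : Fin (n + 1) → F, (∀ u ∈ U, w ⬝ᵥ u = 0) ∧ w ⬝ᵥ y ≠ 0 := by
  obtain ⟨f, hf, hU⟩ := Submodule.exists_le_ker_of_notMem hy
  obtain ⟨w, hw⟩ := exists_eq_dotProduct f
  exact ⟨w, fun u hu => by rw [← hw]; exact hU hu, by rwa [← hw]⟩

theorem exists_dotProduct_eq_one {w : Fin (n + 1) → F} (hw : w ≠ 0) :
    ∃ x : Fin (n + 1) → F, w ⬝ᵥ x = 1 := by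
  obtain ⟨i, hi⟩ := Function.ne_iff.1 hw
  exact ⟨Pi.single i (w i)⁻¹, by rw [dotProduct_single]; exact mul_inv_cancel₀ hi⟩

theorem rank_eq_one_iff_exists_vecMulVec {M : Mat F n} :
    M.rank = 1 ↔ ∃ v w : Fin (n + 1) → F, v ≠ 0 ∧ w ≠ 0 ∧ M = vecMulVec v w := by
  constructor
  · intro h
    obtain ⟨⟨v, hv⟩, hv0, hall⟩ := finrank_eq_one_iff'.1 h
    have hv0' : v ≠ 0 := fun h0 => hv0 (Subtype.ext h0)
    choose! w hw using fun i : Fin (n + 1) =>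
      hall ⟨M *ᵥ Pi.single i 1, ⟨Pi.single i 1, rfl⟩⟩
    have hM : M = vecMulVec v w := by
      ext i j
      have := congrFun (congrArg Subtype.val (hw j)) i
      simp only [SetLike.mk_smul_mk, Pi.smul_apply, smul_eq_mul, mulVec_single_one, col_apply] at this
      rw [vecMulVec_apply, mul_comm, this]
    refine ⟨v, w, hv0', ?_, hM⟩
    rintro rfl
    rw [hM, vecMulVec_zero, rank_zero] at h
    exact zero_ne_one h
  · rintro ⟨v, w, hv, hw, rfl⟩
    refine le_antisymm (rank_vecMulVec_le _ _) (Nat.one_le_iff_ne_zero.2 fun h => ?_)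
    obtain ⟨x, hx⟩ := exists_dotProduct_eq_one hw
    have := (Submodule.finrank_eq_zero (S := LinearMap.range (vecMulVec v w).mulVecLin)).1 h
    have h2 : vecMulVec v w *ᵥ x = 0 := by
      rw [← Submodule.mem_bot F, ← this]; exact ⟨x, rfl⟩
    rw [vecMulVec_mulVec, hx] at h2
    exact hv (by simpa using h2)

/-- The zero vector or an eigenvector. -/
def IsEigen (M : Mat F n) (x : Vec F n) : Prop := ∃ a : F, M *ᵥ x = a • x

/-- A vector outside the span of `x` is separated from it by a functional. In geometric terms, `x`
is an eigenvector exactly when every flag on the point `[x]` lies in `plainHyperplane M`. -/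
theorem isEigen_iff_forall_dotProduct {M : Mat F n} {x : Vec F n} :
    IsEigen M x ↔ ∀ w : Fin (n + 1) → F, w ⬝ᵥ x = 0 → w ⬝ᵥ M *ᵥ x = 0 := by
  constructor
  · rintro ⟨a, ha⟩ w hw
    rw [ha, dotProduct_smul, hw, smul_zero]
  · intro h
    by_contra hn
    have : M *ᵥ x ∉ Submodule.span F {x} := fun hm => by
      obtain ⟨a, ha⟩ := Submodule.mem_span_singleton.1 hm
      exact hn ⟨a, ha.symm⟩
    obtain ⟨w, hw, hw'⟩ := exists_dotProduct_ne_zero this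
    exact hw' (h w (hw x (Submodule.mem_span_singleton_self x)))

theorem exists_eq_scalar_of_forall_isEigen {M : Mat F n} (h : ∀ x, IsEigen M x) :
    ∃ a : F, M = a • (1 : Mat F n) := by
  obtain ⟨a, ha⟩ := exists_eq_smul_of_forall_exists M.mulVecLin LinearMap.id h
  refine ⟨a, ext_of_mulVec_single fun i => ?_⟩
  rw [smul_mulVec, one_mulVec]
  exact LinearMap.congr_fun ha (Pi.single i 1)

theorem isEigen_sub_smul_one {M : Mat F n} (a : F) {x : Vec F n} :
    IsEigen (M - a • (1 : Mat F n)) x ↔ IsEigen M x := by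
  constructor
  · rintro ⟨b, hb⟩
    refine ⟨b + a, ?_⟩
    rw [sub_mulVec, smul_mulVec, one_mulVec, sub_eq_iff_eq_add] at hb
    rw [hb, add_smul]
  · rintro ⟨b, hb⟩
    exact ⟨b - a, by rw [sub_mulVec, smul_mulVec, one_mulVec, hb, sub_smul]⟩

/-- Matrices with a common kernel hyperplane. -/
theorem eq_vecMulVec_of_forall_mulVec_eq_zero {M : Mat F n} {w : Fin (n + 1) → F} {x₀ : Vec F n}
    (hx₀ : w ⬝ᵥ x₀ = 1) (h : ∀ x, w ⬝ᵥ x = 0 → M *ᵥ x = 0) : M = vecMulVec (M *ᵥ x₀) w := by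
  refine ext_of_mulVec_single fun i => ?_
  have := h (Pi.single i 1 - (w ⬝ᵥ Pi.single i 1) • x₀)
    (by rw [dotProduct_sub, dotProduct_smul, hx₀, smul_eq_mul, mul_one, sub_self])
  rw [mulVec_sub, mulVec_smul, sub_eq_zero] at this
  rw [this, vecMulVec_mulVec, op_smul_eq_smul]

/-- All values of the matrix are multiples of `v`, so an eigenvector outside the kernel must itself
be a multiple of `v`. -/
theorem isEigen_vecMulVec {v w : Fin (n + 1) → F} {x : Vec F n} (hv : v ≠ 0) :
    IsEigen (vecMulVec v w) x ↔ w ⬝ᵥ x = 0 ∨ x ∈ Submodule.span F {v} := by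
  unfold IsEigen
  simp only [vecMulVec_mulVec, op_smul_eq_smul, Submodule.mem_span_singleton]
  constructor
  · rintro ⟨a, ha⟩
    by_cases h : w ⬝ᵥ x = 0
    · exact Or.inl h
    · have : a ≠ 0 := by
        rintro rfl
        rw [zero_smul, smul_eq_zero] at ha
        exact ha.elim h hv
      exact Or.inr ⟨a⁻¹ * (w ⬝ᵥ x), by rw [mul_smul, ha, smul_smul, inv_mul_cancel₀ this, one_smul]⟩
  · rintro (h | ⟨b, rfl⟩)
    · exact ⟨0, by rw [h, zero_smul, zero_smul]⟩
    · exact ⟨w ⬝ᵥ v, by rw [dotProduct_smul, smul_eq_mul, smul_smul, mul_comm]⟩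

theorem trace_vecMulVec_mul (x w : Fin (n + 1) → F) (M : Mat F n) :
    (vecMulVec x w * M).trace = w ⬝ᵥ M *ᵥ x := by
  rw [trace_mul_comm, mul_vecMulVec, trace_vecMulVec, dotProduct_comm]

end LinearAlgebra

/-! ### Counting eigenvectors -/

section Counting

variable {F : Type*} [Field F] {n : ℕ}

/-- The eigenvectors of a matrix, with the zero vector. -/
def eigSet (M : Mat F n) : Set (Vec F n) := {x | IsEigen M x}

theorem eigSet_sub_smul_one (M : Mat F n) (a : F) :
    eigSet (M - a • (1 : Mat F n)) = eigSet M :=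
  Set.ext fun _ => isEigen_sub_smul_one a

theorem zero_mem_eigSet (M : Mat F n) : (0 : Vec F n) ∈ eigSet M :=
  ⟨0, by rw [mulVec_zero, smul_zero]⟩

/-- The vectors annihilated by a row vector. -/
def dotKer (w : Fin (n + 1) → F) : Submodule F (Vec F n) :=
  LinearMap.ker (dotProductBilin F F w)

theorem mem_dotKer {w x : Fin (n + 1) → F} : x ∈ dotKer w ↔ w ⬝ᵥ x = 0 := Iff.rfl

theorem finrank_dotKer {w : Fin (n + 1) → F} (hw : w ≠ 0) : Module.finrank F (dotKer w) = n := by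
  have h : dotProductBilin F F w ≠ 0 := fun h => by
    obtain ⟨x, hx⟩ := exists_dotProduct_eq_one hw
    have : w ⬝ᵥ x = 0 := LinearMap.congr_fun h x
    exact one_ne_zero (hx.symm.trans this)
  have := Module.Dual.finrank_ker_add_one_of_ne_zero h
  rw [Module.finrank_fin_fun] at this
  exact Nat.succ_injective this

theorem eigSet_smul_one_add_vecMulVec {v : Fin (n + 1) → F} (hv : v ≠ 0) (a : F)
    (w : Fin (n + 1) → F) :
    eigSet (a • (1 : Mat F n) + vecMulVec v w) =
      (dotKer w : Set (Vec F n)) ∪ Submodule.span F {v} := by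
  rw [← eigSet_sub_smul_one _ a, add_sub_cancel_left]
  exact Set.ext fun x => isEigen_vecMulVec hv

theorem eigSet_eq_univ_iff {M : Mat F n} :
    eigSet M = Set.univ ↔ ∃ a : F, M = a • (1 : Mat F n) := by
  constructor
  · intro h
    exact exists_eq_scalar_of_forall_isEigen fun x => (h ▸ Set.mem_univ x : x ∈ eigSet M)
  · rintro ⟨a, rfl⟩
    exact Set.eq_univ_of_forall fun x => ⟨a, by rw [smul_mulVec, one_mulVec]⟩

theorem ncard_submodule {V : Type*} [AddCommGroup V] [Module F V] [Module.Finite F V]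
    (U : Submodule F V) : (U : Set V).ncard = Nat.card F ^ Module.finrank F U := by
  rw [← Module.natCard_eq_pow_finrank (K := F) (V := U)]; rfl

theorem ncard_eigSet_of_dotProduct_eq_zero {v w : Fin (n + 1) → F} (hv : v ≠ 0) (hw : w ≠ 0)
    (h : w ⬝ᵥ v = 0) (a : F) :
    (eigSet (a • (1 : Mat F n) + vecMulVec v w)).ncard = Nat.card F ^ n := by
  rw [eigSet_smul_one_add_vecMulVec hv, Set.union_eq_left.2, ncard_submodule, finrank_dotKer hw]
  rw [SetLike.coe_subset_coe, Submodule.span_singleton_le_iff_mem]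
  exact h

variable [Finite F]

theorem ncard_eigSet_of_dotProduct_ne_zero {v w : Fin (n + 1) → F} (hv : v ≠ 0) (hw : w ≠ 0)
    (h : w ⬝ᵥ v ≠ 0) (a : F) :
    (eigSet (a • (1 : Mat F n) + vecMulVec v w)).ncard + 1 = Nat.card F ^ n + Nat.card F := by
  have hi : (dotKer w : Set (Vec F n)) ∩ Submodule.span F {v} = {0} := by
    ext x
    simp only [Set.mem_inter_iff, SetLike.mem_coe, mem_dotKer, Submodule.mem_span_singleton,
      Set.mem_singleton_iff]
    constructor
    · rintro ⟨hx, b, rfl⟩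
      rw [dotProduct_smul, smul_eq_mul, mul_eq_zero, or_iff_left h] at hx
      rw [hx, zero_smul]
    · rintro rfl
      exact ⟨dotProduct_zero _, 0, zero_smul _ _⟩
  have := Set.ncard_union_add_ncard_inter (dotKer w : Set (Vec F n)) (Submodule.span F {v})
    (Set.toFinite _) (Set.toFinite _)
  rwa [hi, Set.ncard_singleton, ncard_submodule, finrank_dotKer hw, ncard_submodule,
    finrank_span_singleton hv, pow_one, ← eigSet_smul_one_add_vecMulVec hv a] at this

theorem two_le_natCard (F : Type*) [Field F] [Finite F] : 2 ≤ Nat.card F := Finite.one_lt_card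

/-- The eigenvectors of a matrix with an eigenspace of dimension at least two and no
eigenspace of codimension at most one. -/
theorem ncard_eigSet_lt_of_two_le {M : Mat F n} {a : F}
    (h2 : 2 ≤ Module.finrank F (Module.End.eigenspace (toLin' M) a))
    (hn : Module.finrank F (Module.End.eigenspace (toLin' M) a) + 1 ≤ n) :
    (eigSet M).ncard < Nat.card F ^ n := by
  set E := Module.End.eigenspace (toLin' M) a
  -- All eigenvectors lie in the union of two subspaces meeting in zero: the given eigenspace and
  -- the sum of the others. If the first has dimension `d`, the second has dimension at most `n + 1
  -- - d`.
  set W := ⨆ (b : F) (_ : b ≠ a), Module.End.eigenspace (toLin' M) b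
  have hd : Disjoint E W := Module.End.eigenspaces_iSupIndep (toLin' M) a
  have hdim := Submodule.finrank_add_finrank_le_of_disjoint hd
  rw [Module.finrank_fin_fun] at hdim
  have hsub : eigSet M ⊆ (E : Set (Vec F n)) ∪ W := by
    rintro x ⟨b, hb⟩
    have hx : x ∈ Module.End.eigenspace (toLin' M) b := Module.End.mem_eigenspace_iff.2 hb
    by_cases hba : b = a
    · subst hba; exact Or.inl hx
    · exact Or.inr (Submodule.mem_iSup_of_mem b (Submodule.mem_iSup_of_mem hba hx))
  have hi : (E : Set (Vec F n)) ∩ W = {0} := by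
    rw [← Submodule.coe_inf, hd.eq_bot, Submodule.bot_coe]
  have hu := Set.ncard_union_add_ncard_inter (E : Set (Vec F n)) W (Set.toFinite _) (Set.toFinite _)
  rw [hi, Set.ncard_singleton, ncard_submodule, ncard_submodule] at hu
  have hle := Set.ncard_le_ncard hsub (Set.toFinite _)
  have hq := two_le_natCard F
  have hW : Nat.card F ^ Module.finrank F W ≤ Nat.card F ^ (n + 1 - Module.finrank F E) :=
    Nat.pow_le_pow_right (by omega) (by omega)
  obtain ⟨i, hi'⟩ := Nat.exists_eq_add_of_le h2
  obtain ⟨j, hj⟩ := Nat.exists_eq_add_of_le hn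
  have e : n + 1 - Module.finrank F E = 2 + j := by omega
  have e2 : n = 3 + i + j := by omega
  rw [e] at hW
  rw [hi'] at hu
  -- Both exponents are between 2 and `n - 1`, whence the bound; the zero vector, counted twice,
  -- makes the final inequality strict.
  have key : Nat.card F ^ (2 + i) + Nat.card F ^ (2 + j) ≤ Nat.card F ^ n := by
    rw [e2]
    generalize Nat.card F = q at hq
    have h1 : 1 ≤ q ^ i := Nat.one_le_pow _ _ (by omega)
    have h3 : 1 ≤ q ^ j := Nat.one_le_pow _ _ (by omega)
    rw [pow_add, pow_add, pow_add, pow_add, pow_succ q 2]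
    have : q ^ i + q ^ j ≤ q * (q ^ i * q ^ j) := by
      calc q ^ i + q ^ j ≤ 2 * (q ^ i * q ^ j) := by nlinarith
        _ ≤ _ := Nat.mul_le_mul_right _ hq
    calc q ^ 2 * q ^ i + q ^ 2 * q ^ j = q ^ 2 * (q ^ i + q ^ j) := by ring
      _ ≤ q ^ 2 * (q * (q ^ i * q ^ j)) := Nat.mul_le_mul_left _ this
      _ = _ := by ring
  have := hu.le.trans (Nat.add_le_add_left hW _)
  omega

/-- There are at most `q` eigenvalues, each contributing at most `q - 1` nonzero vectors, so at most
`1 + q * (q - 1)` vectors in all. -/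
theorem ncard_eigSet_add_card_le_of_le_one {M : Mat F n}
    (h : ∀ a : F, Module.finrank F (Module.End.eigenspace (toLin' M) a) ≤ 1) :
    (eigSet M).ncard + Nat.card F ≤ Nat.card F ^ 2 + 1 := by
  classical
  have := Fintype.ofFinite F
  have hsub : eigSet M ⊆ {0} ∪ ⋃ a ∈ (Finset.univ : Finset F),
      (Module.End.eigenspace (toLin' M) a : Set (Vec F n)) \ {0} := by
    rintro x ⟨b, hb⟩
    by_cases hx : x = 0
    · exact Or.inl hx
    · refine Or.inr (Set.mem_biUnion (Finset.mem_coe.2 (Finset.mem_univ b)) ⟨?_, hx⟩)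
      exact Module.End.mem_eigenspace_iff.2 hb
  have h1 := Set.ncard_le_ncard hsub (Set.toFinite _)
  have h2 := h1.trans (Set.ncard_union_le _ _)
  rw [Set.ncard_singleton] at h2
  have h3 : (⋃ a ∈ (Finset.univ : Finset F),
      (Module.End.eigenspace (toLin' M) a : Set (Vec F n)) \ {0}).ncard ≤ Nat.card F * (Nat.card F - 1) := by
    refine (Finset.set_ncard_biUnion_le _ _).trans ?_
    rw [Nat.card_eq_fintype_card, ← Finset.card_univ, ← smul_eq_mul]
    refine Finset.sum_le_card_nsmul _ _ _ fun a _ => ?_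
    rw [Set.ncard_sdiff_singleton_of_mem (Submodule.zero_mem _), ncard_submodule,
      Finset.card_univ, ← Nat.card_eq_fintype_card]
    refine Nat.sub_le_sub_right ?_ 1
    calc _ ≤ Nat.card F ^ 1 := Nat.pow_le_pow_right (by have := two_le_natCard F; omega) (h a)
      _ = _ := pow_one _
  obtain ⟨r, hr⟩ := Nat.exists_eq_add_of_le (two_le_natCard F)
  rw [hr] at h3 ⊢
  have e : (2 + r) * (2 + r - 1) + (2 + r) = (2 + r) ^ 2 := by
    rw [show 2 + r - 1 = 1 + r by omega]; ring
  omega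

/-- A matrix which is neither scalar nor the sum of a scalar matrix and a matrix of rank one has
fewer eigenvectors than a hyperplane. -/
theorem exists_eq_smul_one_add_vecMulVec_or_ncard_eigSet_lt (hn : 1 ≤ n) {M : Mat F n}
    (hM : ∀ a : F, M ≠ a • (1 : Mat F n)) :
    (∃ (a : F) (v w : Fin (n + 1) → F), v ≠ 0 ∧ w ≠ 0 ∧ M = a • (1 : Mat F n) + vecMulVec v w) ∨
      (eigSet M).ncard < Nat.card F ^ n := by
  by_cases h : ∃ a : F, n ≤ Module.finrank F (Module.End.eigenspace (toLin' M) a)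
  · left
    obtain ⟨a, ha⟩ := h
    have he : Module.End.eigenspace (toLin' M) a = LinearMap.ker (M - a • (1 : Mat F n)).mulVecLin := by
      ext x
      rw [Module.End.mem_eigenspace_iff, LinearMap.mem_ker, mulVecLin_apply, sub_mulVec,
        smul_mulVec, one_mulVec, sub_eq_zero, toLin'_apply]
    have hr := LinearMap.finrank_range_add_finrank_ker (M - a • (1 : Mat F n)).mulVecLin
    rw [← he, Module.finrank_fin_fun] at hr
    have h1 : (M - a • (1 : Mat F n)).rank ≤ 1 := by
      change Module.finrank F _ ≤ 1
      omega
    have h0 : (M - a • (1 : Mat F n)).rank ≠ 0 := by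
      intro h0
      have := LinearMap.range_eq_bot.1 (Submodule.finrank_eq_zero.1 h0)
      rw [← mulVecLin_zero] at this
      exact hM a (sub_eq_zero.1 (mulVec_injective (LinearMap.ext_iff.1 this |> funext)))
    obtain ⟨v, w, hv, hw, e⟩ := rank_eq_one_iff_exists_vecMulVec.1
      (le_antisymm h1 (Nat.one_le_iff_ne_zero.2 h0))
    exact ⟨a, v, w, hv, hw, by rw [← e]; abel⟩
  · right
    push Not at h
    by_cases h2 : ∃ a : F, 2 ≤ Module.finrank F (Module.End.eigenspace (toLin' M) a)
    · obtain ⟨a, ha⟩ := h2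
      exact ncard_eigSet_lt_of_two_le ha (h a)
    · push Not at h2
      -- The bound `q ^ 2 - q + 1` is below `q ^ n` only for `n ≥ 2`. For `n = 1` all eigenspaces
      -- are zero here.
      obtain rfl | hn2 : n = 1 ∨ 2 ≤ n := by omega
      · have hsub : eigSet M ⊆ {0} := by
          rintro x ⟨b, hb⟩
          have hx : x ∈ Module.End.eigenspace (toLin' M) b := Module.End.mem_eigenspace_iff.2 hb
          rwa [Submodule.finrank_eq_zero.1 (Nat.lt_one_iff.1 (h b))] at hx
        have := Set.ncard_le_ncard hsub (Set.toFinite _)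
        rw [Set.ncard_singleton] at this
        have := two_le_natCard F
        rw [pow_one]
        omega
      · have h3 := ncard_eigSet_add_card_le_of_le_one fun a => Nat.lt_succ_iff.1 (h2 a)
        have h4 : Nat.card F ^ 2 ≤ Nat.card F ^ n :=
          Nat.pow_le_pow_right (by have := two_le_natCard F; omega) hn2
        have := two_le_natCard F
        omega

/-- The possible numbers of eigenvectors of a matrix which is not scalar. -/
theorem ncard_eigSet_trichotomy (hn : 1 ≤ n) {M : Mat F n} (hM : ∀ a : F, M ≠ a • (1 : Mat F n)) :
    (∃ (a : F) (v w : Fin (n + 1) → F), v ≠ 0 ∧ w ≠ 0 ∧ w ⬝ᵥ v ≠ 0 ∧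
      M = a • (1 : Mat F n) + vecMulVec v w ∧
      (eigSet M).ncard + 1 = Nat.card F ^ n + Nat.card F) ∨
    (∃ (a : F) (v w : Fin (n + 1) → F), v ≠ 0 ∧ w ≠ 0 ∧ w ⬝ᵥ v = 0 ∧
      M = a • (1 : Mat F n) + vecMulVec v w ∧ (eigSet M).ncard = Nat.card F ^ n) ∨
    (eigSet M).ncard < Nat.card F ^ n := by
  obtain ⟨a, v, w, hv, hw, rfl⟩ | h := exists_eq_smul_one_add_vecMulVec_or_ncard_eigSet_lt hn hM
  · by_cases h : w ⬝ᵥ v = 0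
    · exact Or.inr (Or.inl ⟨a, v, w, hv, hw, h, rfl,
        ncard_eigSet_of_dotProduct_eq_zero hv hw h a⟩)
    · exact Or.inl ⟨a, v, w, hv, hw, h, rfl, ncard_eigSet_of_dotProduct_ne_zero hv hw h a⟩
  · exact Or.inr (Or.inr h)

end Counting

/-! ### Matrices lying pointwise in the span of the identity and another matrix -/

section LocalSpan

variable {F : Type*} [Field F] {n : ℕ}

/-- A matrix which locally lies in the span of the identity and a matrix of rank one, and which has
no further eigenvectors, lies in that span. -/
theorem exists_eq_add_smul_vecMulVec {M' : Mat F n} {p w : Fin (n + 1) → F} (hp : p ≠ 0)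
    (hw : w ≠ 0) (h : ∀ x, ∃ α β : F, M' *ᵥ x = α • x + β • vecMulVec p w *ᵥ x)
    (he : ∀ x, IsEigen M' x → IsEigen (vecMulVec p w) x) :
    ∃ m l : F, M' = m • (1 : Mat F n) + l • vecMulVec p w := by
  obtain ⟨x₀, hx₀⟩ := exists_dotProduct_eq_one hw
  -- On the kernel of `w` the rank one term vanishes, so `M'` acts there as one scalar `m`, and `M'
  -- - m • 1` is `vecMulVec v w` for some `v`. It remains to see that `v` is a multiple of `p`.
  obtain ⟨m, hm⟩ := exists_eq_smul_of_forall_exists (M'.mulVecLin ∘ₗ (dotKer w).subtype)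
    (dotKer w).subtype (by
      rintro ⟨x, hx⟩
      obtain ⟨α, β, hab⟩ := h x
      refine ⟨α, ?_⟩
      change M' *ᵥ x = α • x
      rw [hab, vecMulVec_mulVec, mem_dotKer.1 hx, MulOpposite.op_zero, zero_smul, smul_zero,
        add_zero])
  have hN := eq_vecMulVec_of_forall_mulVec_eq_zero (M := M' - m • (1 : Mat F n)) hx₀ fun x hx => by
    rw [sub_mulVec, smul_mulVec, one_mulVec, sub_eq_zero]
    exact LinearMap.congr_fun hm ⟨x, hx⟩
  set v := (M' - m • (1 : Mat F n)) *ᵥ x₀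
  have hM' : M' = m • (1 : Mat F n) + vecMulVec v w := by rw [← hN]; abel
  suffices hv : v ∈ Submodule.span F {p} by
    obtain ⟨l, hl⟩ := Submodule.mem_span_singleton.1 hv
    exact ⟨m, l, by rw [hM', ← hl, smul_vecMulVec]⟩
  by_contra hv
  have hv0 : v ≠ 0 := fun h0 => hv (h0 ▸ Submodule.zero_mem _)
  have hloc : ∀ x, ∃ α β : F, (w ⬝ᵥ x) • v = α • x + β • p := fun x => by
    obtain ⟨α, β, hab⟩ := h x
    refine ⟨α - m, β * (w ⬝ᵥ x), ?_⟩
    rw [hM', add_mulVec, smul_mulVec, one_mulVec, vecMulVec_mulVec, vecMulVec_mulVec,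
      op_smul_eq_smul, op_smul_eq_smul, smul_smul] at hab
    rw [sub_smul, sub_add_eq_add_sub, ← hab, add_sub_cancel_left]
  -- If `w ⬝ᵥ p = 0`, then `v`, being an eigenvector of `M'`, is one of `vecMulVec p w`, which gives
  -- `w ⬝ᵥ v = 0`; pairing the local relation at `x₀` with `w` then kills its `x₀` term. Otherwise
  -- the local relation at `p` suffices.
  by_cases hwp : w ⬝ᵥ p = 0
  · have hev : IsEigen M' v := (isEigen_sub_smul_one m).1 (by
      rw [hN]; exact (isEigen_vecMulVec hv0).2 (Or.inr (Submodule.mem_span_singleton_self v)))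
    have hwv := ((isEigen_vecMulVec hp).1 (he v hev)).resolve_right hv
    obtain ⟨α, β, hab⟩ := hloc x₀
    rw [hx₀, one_smul] at hab
    have h1 := congrArg (fun y => w ⬝ᵥ y) hab
    simp only [dotProduct_add, dotProduct_smul, hwv, hx₀, hwp, smul_eq_mul, mul_one, mul_zero,
      add_zero] at h1
    rw [← h1, zero_smul, zero_add] at hab
    exact hv (Submodule.mem_span_singleton.2 ⟨β, hab.symm⟩)
  · obtain ⟨α, β, hab⟩ := hloc p
    refine hv (Submodule.mem_span_singleton.2 ⟨(w ⬝ᵥ p)⁻¹ * (α + β), ?_⟩)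
    rw [mul_smul, add_smul, ← hab, smul_smul, inv_mul_cancel₀ hwp, one_smul]

theorem exists_eq_vecMulVec_of_forall_exists {N : Mat F n} {v : Vec F n}
    (h : ∀ x, ∃ c : F, N *ᵥ x = c • v) : ∃ w, N = vecMulVec v w := by
  choose w hw using fun i : Fin (n + 1) => h (Pi.single i 1)
  refine ⟨w, ext_of_mulVec_single fun i => ?_⟩
  rw [hw, vecMulVec_mulVec, op_smul_eq_smul, dotProduct_single, mul_one]

theorem exists_notMem_span (s : Finset (Vec F n)) (hs : s.card < n + 1) :
    ∃ x, x ∉ Submodule.span F (s : Set (Vec F n)) := by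
  by_contra! h
  have h1 := finrank_span_finset_le_card (R := F) s
  rw [Set.finrank, Submodule.eq_top_iff'.2 h, finrank_top, Module.finrank_fin_fun] at h1
  omega

/-- Compare `M` at `x` and at `x + v`: the difference writes `M *ᵥ v` as a multiple of `x` plus a
multiple of `v`, and for `x` outside the span of `v` and `M *ᵥ v` the first must vanish. Both
vectors must avoid the kernel of `w`, which needs a scalar `t` other than `0` and `-(w ⬝ᵥ v)`. Over
the field of two elements there is none, and for `n ≥ 3` three vectors `x`, `x'`, `x + x' - v` with
the same value of `w` replace the pair. -/
theorem isEigen_of_forall_mem_span {M : Mat F n} {v w : Fin (n + 1) → F} (hwv : w ⬝ᵥ v ≠ 0)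
    (h : ∀ x, w ⬝ᵥ x ≠ 0 → x ∉ Submodule.span F {v} → ∃ a b : F, M *ᵥ x = a • x + b • v)
    (hn : 3 ≤ n ∨ 2 ≤ n ∧ ∃ t : F, t ≠ 0 ∧ t + w ⬝ᵥ v ≠ 0) : IsEigen M v := by
  classical
  by_contra hev
  have hu : M *ᵥ v ∉ Submodule.span F {v} := fun hm => by
    obtain ⟨a, ha⟩ := Submodule.mem_span_singleton.1 hm
    exact hev ⟨a, ha.symm⟩
  -- Adding a multiple of `v` gives `w` any prescribed value without entering a subspace that
  -- contains `v`.
  have adjust : ∀ (U : Submodule F (Vec F n)) (t : F) (y : Vec F n), v ∈ U → y ∉ U →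
      ∃ x, x ∉ U ∧ w ⬝ᵥ x = t := fun U t y hv hy => by
    refine ⟨y + ((t - w ⬝ᵥ y) / (w ⬝ᵥ v)) • v, fun hm => hy ?_, ?_⟩
    · simpa using Submodule.sub_mem _ hm (Submodule.smul_mem _ ((t - w ⬝ᵥ y) / (w ⬝ᵥ v)) hv)
    · rw [dotProduct_add, dotProduct_smul, smul_eq_mul, div_mul_cancel₀ _ hwv]; ring
  have hmem : ∀ (U : Submodule F (Vec F n)) (x : Vec F n), v ∈ U → x ∉ U →
      x ∉ Submodule.span F {v} := fun U x hv hx hm =>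
    hx ((Submodule.span_singleton_le_iff_mem v U).2 hv hm)
  have hcancel : ∀ (U : Submodule F (Vec F n)) (c : F) (x : Vec F n), c • x ∈ U → x ∉ U → c = 0 :=
    fun U c x hm hx => by
      by_contra hc
      exact hx ((U.smul_mem_iff hc).1 hm)
  have h2n : 2 ≤ n := hn.elim (fun h => by omega) And.left
  obtain ⟨y, hy⟩ := exists_notMem_span ({v, M *ᵥ v} : Finset (Vec F n))
    (Finset.card_le_two.trans_lt (by omega))
  set U := Submodule.span F ((({v, M *ᵥ v} : Finset (Vec F n)) : Set (Vec F n)))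
  have hvU : v ∈ U := Submodule.subset_span (by simp)
  have huU : M *ᵥ v ∈ U := Submodule.subset_span (by simp)
  rcases hn with hn | ⟨-, t, ht, ht'⟩
  · obtain ⟨x, hxU, hxw⟩ := adjust U (w ⬝ᵥ v) y hvU hy
    obtain ⟨y', hy'⟩ := exists_notMem_span ({v, M *ᵥ v, x} : Finset (Vec F n))
      (Finset.card_le_three.trans_lt (by omega))
    set U' := Submodule.span F ((({v, M *ᵥ v, x} : Finset (Vec F n)) : Set (Vec F n)))
    have hvU' : v ∈ U' := Submodule.subset_span (by simp)
    have huU' : M *ᵥ v ∈ U' := Submodule.subset_span (by simp)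
    have hxU' : x ∈ U' := Submodule.subset_span (by simp)
    obtain ⟨x', hxU2, hxw2⟩ := adjust U' (w ⬝ᵥ v) y' hvU' hy'
    have hz : x + x' - v ∉ U' := fun hm => hxU2 (by
      have := Submodule.sub_mem _ (Submodule.add_mem _ hm hvU') hxU'
      simpa using this)
    obtain ⟨a, b, e⟩ := h x (hxw ▸ hwv) (hmem U x hvU hxU)
    obtain ⟨a', b', e'⟩ := h x' (hxw2 ▸ hwv) (hmem U' x' hvU' hxU2)
    obtain ⟨a'', b'', e''⟩ := h (x + x' - v)
      (by rw [dotProduct_sub, dotProduct_add, hxw, hxw2, add_sub_cancel_right]; exact hwv)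
      (hmem U' _ hvU' hz)
    rw [mulVec_sub, mulVec_add, e, e'] at e''
    have key : M *ᵥ v = (a - a'') • x + (a' - a'') • x' + (b + b' + a'' - b'') • v := by
      have : M *ᵥ v = a • x + b • v + (a' • x' + b' • v) - (a'' • (x + x' - v) + b'' • v) := by
        rw [← e'']; abel
      rw [this]; module
    have h1 : a' - a'' = 0 := hcancel U' _ x' (by
      have : (a' - a'') • x' = M *ᵥ v - (a - a'') • x - (b + b' + a'' - b'') • v := by
        rw [key]; abel
      rw [this]
      exact Submodule.sub_mem _ (Submodule.sub_mem _ huU' (Submodule.smul_mem _ _ hxU'))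
        (Submodule.smul_mem _ _ hvU')) hxU2
    rw [h1, zero_smul, add_zero] at key
    have h2 : a - a'' = 0 := hcancel U _ x (by
      have : (a - a'') • x = M *ᵥ v - (b + b' + a'' - b'') • v := by
        rw [key]; abel
      rw [this]
      exact Submodule.sub_mem _ huU (Submodule.smul_mem _ _ hvU)) hxU
    rw [h2, zero_smul, zero_add] at key
    exact hev ⟨_, key⟩
  · obtain ⟨x, hxU, hxw⟩ := adjust U t y hvU hy
    have hz : x + v ∉ U := fun hm => hxU (by
      simpa using Submodule.sub_mem _ hm hvU)
    obtain ⟨a, b, e⟩ := h x (hxw ▸ ht) (hmem U x hvU hxU)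
    obtain ⟨a', b', e'⟩ := h (x + v) (by rw [dotProduct_add, hxw]; exact ht') (hmem U _ hvU hz)
    rw [mulVec_add, e] at e'
    have key : M *ᵥ v = (a' - a) • x + (a' + b' - b) • v := by
      have : M *ᵥ v = a' • (x + v) + b' • v - (a • x + b • v) := by rw [← e']; abel
      rw [this]; module
    have h2 : a' - a = 0 := hcancel U _ x (by
      have : (a' - a) • x = M *ᵥ v - (a' + b' - b) • v := by
        rw [key]; abel
      rw [this]
      exact Submodule.sub_mem _ huU (Submodule.smul_mem _ _ hvU)) hxU
    rw [h2, zero_smul, zero_add] at key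
    exact hev ⟨_, key⟩

/-- Modulo `v` every vector becomes an eigenvector, so `M` acts as a scalar `s` on the quotient and
`M - s • 1` maps into the span of `v`. A vector in the kernel of `w` is handled through its
translate by `v`. -/
theorem exists_eq_smul_one_add_vecMulVec_of_isEigen {M : Mat F n} {v w : Fin (n + 1) → F}
    (hwv : w ⬝ᵥ v ≠ 0)
    (h : ∀ x, w ⬝ᵥ x ≠ 0 → x ∉ Submodule.span F {v} → ∃ a b : F, M *ᵥ x = a • x + b • v)
    (hv : IsEigen M v) : ∃ (s : F) (w' : Fin (n + 1) → F), M = s • (1 : Mat F n) + vecMulVec v w' := by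
  set S := Submodule.span F {v}
  have hvS : v ∈ S := Submodule.mem_span_singleton_self v
  have hMv : M *ᵥ v ∈ S := by
    obtain ⟨a, ha⟩ := hv
    rw [ha]; exact Submodule.smul_mem _ _ hvS
  have step : ∀ x, w ⬝ᵥ x ≠ 0 → ∃ a : F, M *ᵥ x - a • x ∈ S := fun x hx => by
    by_cases hxS : x ∈ S
    · obtain ⟨c, rfl⟩ := Submodule.mem_span_singleton.1 hxS
      exact ⟨0, by rw [mulVec_smul, zero_smul, sub_zero]; exact Submodule.smul_mem _ _ hMv⟩
    · obtain ⟨a, b, e⟩ := h x hx hxS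
      exact ⟨a, by rw [e, add_sub_cancel_left]; exact Submodule.smul_mem _ _ hvS⟩
  obtain ⟨s, hs⟩ := exists_eq_smul_of_forall_exists (S.mkQ ∘ₗ M.mulVecLin) S.mkQ fun x => by
    by_cases hx : w ⬝ᵥ x = 0
    · obtain ⟨a, ha⟩ := step (x + v) (by rwa [dotProduct_add, hx, zero_add])
      refine ⟨a, ?_⟩
      rw [← map_smul, ← sub_eq_zero, LinearMap.comp_apply, ← map_sub, Submodule.mkQ_apply,
        Submodule.Quotient.mk_eq_zero, mulVecLin_apply]
      have : M *ᵥ x - a • x = M *ᵥ (x + v) - a • (x + v) - M *ᵥ v + a • v := by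
        rw [mulVec_add, smul_add]; abel
      rw [this]
      exact Submodule.add_mem _ (Submodule.sub_mem _ ha hMv) (Submodule.smul_mem _ _ hvS)
    · obtain ⟨a, ha⟩ := step x hx
      refine ⟨a, ?_⟩
      rwa [← map_smul, ← sub_eq_zero, LinearMap.comp_apply, ← map_sub, Submodule.mkQ_apply,
        Submodule.Quotient.mk_eq_zero, mulVecLin_apply]
  obtain ⟨w', hw'⟩ := exists_eq_vecMulVec_of_forall_exists (N := M - s • (1 : Mat F n)) (v := v)
    fun x => by
      have := LinearMap.congr_fun hs x
      rw [LinearMap.smul_apply, ← map_smul, ← sub_eq_zero, LinearMap.comp_apply, ← map_sub,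
        Submodule.mkQ_apply, Submodule.Quotient.mk_eq_zero] at this
      obtain ⟨c, hc⟩ := Submodule.mem_span_singleton.1 this
      exact ⟨c, by rw [hc, sub_mulVec, smul_mulVec, one_mulVec]; rfl⟩
  exact ⟨s, w', by rw [← hw']; abel⟩

/-- Double counting of the pairs `(l, x)`: an eigenvector of `M` is one of every `M' - l • M`, while
any other `x` is one for exactly one `l`, namely the coefficient `β` of `M *ᵥ x`. -/
theorem sum_ncard_eigSet_sub_smul [Fintype F] {M M' : Mat F n}
    (h : ∀ x, ∃ α β : F, M' *ᵥ x = α • x + β • M *ᵥ x) :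
    ∑ l : F, (eigSet (M' - l • M)).ncard + (eigSet M).ncard =
      Nat.card F ^ (n + 1) + Nat.card F * (eigSet M).ncard := by
  classical
  have hcard : ∀ x, (Finset.univ.filter fun l : F => IsEigen (M' - l • M) x).card =
      if IsEigen M x then Nat.card F else 1 := fun x => by
    obtain ⟨α, β, hab⟩ := h x
    split_ifs with hx
    · obtain ⟨b, hb⟩ := hx
      rw [Finset.filter_true_of_mem, Finset.card_univ, Nat.card_eq_fintype_card]
      intro l _
      refine ⟨α + β * b - l * b, ?_⟩
      rw [sub_mulVec, smul_mulVec, hab, hb]; module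
    · rw [Finset.card_eq_one]
      refine ⟨β, Finset.ext fun l => ?_⟩
      rw [Finset.mem_filter, Finset.mem_singleton, and_iff_right (Finset.mem_univ l)]
      constructor
      · rintro ⟨c, hc⟩
        rw [sub_mulVec, smul_mulVec, hab] at hc
        by_contra hne
        have hne' : β - l ≠ 0 := sub_ne_zero.2 (Ne.symm hne)
        refine hx ⟨(β - l)⁻¹ * (c - α), ?_⟩
        have : (β - l) • M *ᵥ x = (c - α) • x := by
          rw [sub_smul c, ← hc]; module
        rw [mul_smul, ← this, smul_smul, inv_mul_cancel₀ hne', one_smul]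
      · rintro rfl
        exact ⟨α, by rw [sub_mulVec, smul_mulVec, hab, add_sub_cancel_right]⟩
  have hn : ∀ A : Mat F n, (eigSet A).ncard = (Finset.univ.filter fun x => IsEigen A x).card :=
    fun A => by rw [← Set.ncard_coe_finset]; congr 1; ext; simp [eigSet]
  have hsum : ∑ l : F, (eigSet (M' - l • M)).ncard =
      ∑ x : Vec F n, if IsEigen M x then Nat.card F else 1 := by
    simp_rw [hn, ← hcard, Finset.card_filter]
    exact Finset.sum_comm
  have htot := Finset.card_filter_add_card_filter_not (s := (Finset.univ : Finset (Vec F n)))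
    (fun x => IsEigen M x)
  have huniv : (Finset.univ : Finset (Vec F n)).card = Nat.card F ^ (n + 1) := by
    rw [Finset.card_univ, Fintype.card_fun, Fintype.card_fin, Nat.card_eq_fintype_card]
  rw [huniv] at htot
  rw [hsum, Finset.sum_ite, Finset.sum_const, Finset.sum_const, smul_eq_mul, smul_eq_mul, mul_one,
    hn M, ← htot]
  ring

/-- A matrix which locally lies in the span of the identity and another matrix lies in that
span. -/
theorem exists_eq_add_smul_of_forall_exists [Finite F] (hn : 2 ≤ n)
    (hnq : ¬(n = 2 ∧ Nat.card F = 2)) {M M' : Mat F n} (hM : ∀ a : F, M ≠ a • (1 : Mat F n))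
    (h : ∀ x, ∃ α β : F, M' *ᵥ x = α • x + β • M *ᵥ x) :
    ∃ m l : F, M' = m • (1 : Mat F n) + l • M := by
  have := Fintype.ofFinite F
  by_contra! hcon
  have hns : ∀ l a : F, M' - l • M ≠ a • (1 : Mat F n) := fun l a e =>
    hcon a l (by rw [← e]; abel)
  have hsum := sum_ncard_eigSet_sub_smul h
  have hq := two_le_natCard F
  have hpow : Nat.card F ^ (n + 1) = Nat.card F * Nat.card F ^ n := by ring
  have hle : ∀ l : F, (eigSet (M' - l • M)).ncard ≤ Nat.card F ^ n + (Nat.card F - 1) := fun l => by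
    obtain ⟨_, _, _, _, _, _, _, h⟩ | ⟨_, _, _, _, _, _, _, h⟩ | h :=
      ncard_eigSet_trichotomy (by omega) (hns l) <;> omega
  have he1 : 1 ≤ (eigSet M).ncard :=
    (Set.ncard_pos (Set.toFinite _)).2 ⟨0, zero_mem_eigSet M⟩
  obtain ⟨r, hr⟩ := Nat.exists_eq_add_of_le hq
  -- The `q` summands total `q ^ (n + 1) + (q - 1) * |eigSet M|`, which exceeds `q * q ^ n` because
  -- zero belongs to `eigSet M`.
  have hbig : ∃ l : F, Nat.card F ^ n < (eigSet (M' - l • M)).ncard := by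
    by_contra! hsmall
    have := Finset.sum_le_card_nsmul Finset.univ _ _ fun l _ => hsmall l
    rw [Finset.card_univ, ← Nat.card_eq_fintype_card, smul_eq_mul] at this
    have : (eigSet M).ncard * 2 ≤ Nat.card F * (eigSet M).ncard := by
      rw [mul_comm]; exact Nat.mul_le_mul_right _ hq
    omega
  obtain ⟨l, hl⟩ := hbig
  obtain ⟨a, v, w, hv, hw, hwv, e, -⟩ | ⟨_, _, _, _, _, _, _, h⟩ | h :=
    ncard_eigSet_trichotomy (by omega) (hns l)
  -- Evaluating both forms of `M' - l • M` at `x` expresses a nonzero multiple of `v` through `x`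
  -- and `M *ᵥ x`; the coefficient of `M *ᵥ x` is nonzero because `x` is not a multiple of `v`.
  · have hspan : ∀ x, w ⬝ᵥ x ≠ 0 → x ∉ Submodule.span F {v} →
        ∃ a b : F, M *ᵥ x = a • x + b • v := fun x hx hxv => by
      obtain ⟨α, β, hab⟩ := h x
      have e' : (w ⬝ᵥ x) • v = (α - a) • x + (β - l) • M *ᵥ x := by
        have : (w ⬝ᵥ x) • v = (M' - l • M) *ᵥ x - a • x := by
          rw [e, add_mulVec, smul_mulVec, one_mulVec, vecMulVec_mulVec, op_smul_eq_smul,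
            add_sub_cancel_left]
        rw [this, sub_mulVec, smul_mulVec, hab]; module
      by_cases hb : β - l = 0
      · exfalso
        rw [hb, zero_smul, add_zero] at e'
        have ha : α - a ≠ 0 := fun h0 => by
          rw [h0, zero_smul, smul_eq_zero] at e'
          exact e'.elim hx hv
        exact hxv ((Submodule.smul_mem_iff _ ha).1
          (e' ▸ Submodule.smul_mem _ _ (Submodule.mem_span_singleton_self v)))
      · refine ⟨-(β - l)⁻¹ * (α - a), (β - l)⁻¹ * (w ⬝ᵥ x), ?_⟩
        rw [mul_smul (β - l)⁻¹, e', smul_add, smul_smul _ (β - l), inv_mul_cancel₀ hb]; module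
    have hcase : 3 ≤ n ∨ 2 ≤ n ∧ ∃ t : F, t ≠ 0 ∧ t + w ⬝ᵥ v ≠ 0 := by
      by_cases h3 : 3 ≤ n
      · exact Or.inl h3
      · right
        refine ⟨hn, ?_⟩
        classical
        have hc : ({0, -(w ⬝ᵥ v)} : Finset F).card < Fintype.card F :=
          Finset.card_le_two.trans_lt (by rw [← Nat.card_eq_fintype_card]; omega)
        obtain ⟨t, ht⟩ := Finset.exists_mem_notMem_of_card_lt_card
          (s := {0, -(w ⬝ᵥ v)}) (t := Finset.univ) (by rwa [Finset.card_univ])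
        simp only [Finset.mem_insert, Finset.mem_singleton, not_or] at ht
        exact ⟨t, ht.2.1, fun h0 => ht.2.2 (eq_neg_of_add_eq_zero_left h0)⟩
    obtain ⟨s, w', rfl⟩ := exists_eq_smul_one_add_vecMulVec_of_isEigen hwv hspan
      (isEigen_of_forall_mem_span hwv hspan hcase)
    have hw' : w' ≠ 0 := fun h0 => hM s (by rw [h0, vecMulVec_zero, add_zero])
    have hlow : Nat.card F ^ n ≤ (eigSet (s • (1 : Mat F n) + vecMulVec v w')).ncard := by
      by_cases h0 : w' ⬝ᵥ v = 0
      · exact (ncard_eigSet_of_dotProduct_eq_zero hv hw' h0 s).ge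
      · have := ncard_eigSet_of_dotProduct_ne_zero hv hw' h0 s
        omega
    -- With `g` the number of eigenvectors of `M`, the sum formula and the bound `q ^ n + q - 1` on
    -- each summand give `(q - 1) * g ≤ q * (q - 1)`, hence `g ≤ q`, against `g ≥ q ^ n ≥ q ^ 2`.
    have h2 := Finset.sum_le_card_nsmul Finset.univ _ _ fun l _ => hle l
    rw [Finset.card_univ, ← Nat.card_eq_fintype_card, smul_eq_mul, mul_add] at h2
    have hpn : Nat.card F ^ 2 ≤ Nat.card F ^ n := Nat.pow_le_pow_right (by omega) hn
    generalize (eigSet (s • (1 : Mat F n) + vecMulVec v w')).ncard = g at *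
    have h5 : Nat.card F * g ≤ Nat.card F * (Nat.card F - 1) + g := by omega
    have h6 := hpn.trans hlow
    rw [hr] at h5 h6
    rw [show 2 + r - 1 = 1 + r by omega] at h5
    nlinarith
  · omega
  · omega

end LocalSpan

/-! ### Flags, plain hyperplanes, words and their weights -/

section Geometry

variable {F : Type*} [Field F] {n : ℕ}

theorem segre_mk {x w : Fin (n + 1) → F} (hx : x ≠ 0) (hw : w ≠ 0) :
    segre (Projectivization.mk F x hx, Projectivization.mk F w hw) =
      Projectivization.mk F (vecMulVec x w) (vecMulVec_ne_zero hx hw) := by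
  obtain ⟨a, ha⟩ := Projectivization.exists_smul_eq_mk_rep F x hx
  obtain ⟨b, hb⟩ := Projectivization.exists_smul_eq_mk_rep F w hw
  unfold segre
  rw [Projectivization.mk_eq_mk_iff']
  refine ⟨(a : F) * b, ?_⟩
  rw [← ha, ← hb, Units.smul_def, Units.smul_def, smul_vecMulVec, vecMulVec_smul, smul_smul]

theorem mk_mem_flags {x w : Fin (n + 1) → F} (hx : x ≠ 0) (hw : w ≠ 0) :
    (Projectivization.mk F x hx, Projectivization.mk F w hw) ∈ flags F n ↔ w ⬝ᵥ x = 0 := Iff.rfl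

theorem mk_mem_plainHyperplane {x w : Fin (n + 1) → F} (hx : x ≠ 0) (hw : w ≠ 0) (M : Mat F n) :
    (Projectivization.mk F x hx, Projectivization.mk F w hw) ∈ plainHyperplane M ↔
      w ⬝ᵥ x = 0 ∧ w ⬝ᵥ M *ᵥ x = 0 := by
  unfold plainHyperplane
  rw [Set.mem_ofPred_eq, mk_mem_flags, segre_mk hx hw, Projectivization.submodule_mk]
  refine and_congr_right fun _ => ?_
  rw [← trace_vecMulVec_mul]
  constructor
  · exact fun h => h _ (Submodule.mem_span_singleton_self _)
  · intro h Y hY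
    obtain ⟨c, rfl⟩ := Submodule.mem_span_singleton.1 hY
    rw [smul_mul, trace_smul, h, smul_zero]

theorem forall_segrePoint {P : SegrePoint F n → Prop}
    (h : ∀ (x w : Fin (n + 1) → F) (hx : x ≠ 0) (hw : w ≠ 0),
      P (Projectivization.mk F x hx, Projectivization.mk F w hw)) (z : SegrePoint F n) : P z := by
  obtain ⟨p, A⟩ := z
  induction p with | h x hx => induction A with | h w hw => exact h x w hx hw

theorem plainHyperplane_subset_iff {M M' : Mat F n} :
    plainHyperplane M ⊆ plainHyperplane M' ↔
      ∀ x w : Fin (n + 1) → F, w ⬝ᵥ x = 0 → w ⬝ᵥ M *ᵥ x = 0 → w ⬝ᵥ M' *ᵥ x = 0 := by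
  constructor
  · intro h x w h0 h1
    by_cases hx : x = 0
    · rw [hx, mulVec_zero, dotProduct_zero]
    by_cases hw : w = 0
    · rw [hw, zero_dotProduct]
    exact ((mk_mem_plainHyperplane hx hw M').1 (h ((mk_mem_plainHyperplane hx hw M).2 ⟨h0, h1⟩))).2
  · intro h z
    induction z using forall_segrePoint with | h x w hx hw =>
    rw [mk_mem_plainHyperplane, mk_mem_plainHyperplane]
    exact fun hm => ⟨hm.1, h x w hm.1 hm.2⟩

/-- Otherwise a functional `w` vanishing on `x` and `M *ᵥ x` but not on `M' *ᵥ x` would give a flag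
in the first hyperplane and outside the second. -/
theorem exists_eq_of_plainHyperplane_subset {M M' : Mat F n}
    (h : plainHyperplane M ⊆ plainHyperplane M') (x : Vec F n) :
    ∃ α β : F, M' *ᵥ x = α • x + β • M *ᵥ x := by
  by_contra hn
  have : M' *ᵥ x ∉ Submodule.span F {x, M *ᵥ x} := fun hm => by
    obtain ⟨a, b, e⟩ := Submodule.mem_span_pair.1 hm
    exact hn ⟨a, b, e.symm⟩
  obtain ⟨w, hw, hw'⟩ := exists_dotProduct_ne_zero this
  exact hw' (plainHyperplane_subset_iff.1 h x w (hw _ (Submodule.subset_span (by simp)))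
    (hw _ (Submodule.subset_span (by simp))))

theorem eigSet_mono {M M' : Mat F n} (h : plainHyperplane M ⊆ plainHyperplane M') :
    eigSet M ⊆ eigSet M' := fun x hx =>
  isEigen_iff_forall_dotProduct.2 fun w hw =>
    plainHyperplane_subset_iff.1 h x w hw (isEigen_iff_forall_dotProduct.1 hx w hw)

theorem eigSet_eq_of_plainHyperplane_eq {M M' : Mat F n}
    (h : plainHyperplane M = plainHyperplane M') : eigSet M = eigSet M' :=
  (eigSet_mono h.le).antisymm (eigSet_mono h.ge)

theorem segre_injective : Function.Injective (segre : SegrePoint F n → _) := by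
  intro z z'
  induction z using forall_segrePoint with | h x w hx hw =>
  induction z' using forall_segrePoint with | h x' w' hx' hw' =>
  intro h
  rw [segre_mk hx hw, segre_mk hx' hw', Projectivization.mk_eq_mk_iff'] at h
  obtain ⟨a, ha⟩ := h
  obtain ⟨y, hy⟩ := exists_dotProduct_eq_one hw
  obtain ⟨u, hu⟩ := exists_dotProduct_eq_one hx
  rw [Prod.mk.injEq, Projectivization.mk_eq_mk_iff', Projectivization.mk_eq_mk_iff']
  constructor
  · refine ⟨a * (w' ⬝ᵥ y), ?_⟩
    have := congrArg (· *ᵥ y) ha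
    simp only [smul_mulVec, vecMulVec_mulVec, op_smul_eq_smul, hy, one_smul] at this
    rw [mul_smul, this]
  · refine ⟨a * (x' ⬝ᵥ u), ?_⟩
    have := congrArg (u ᵥ* ·) ha
    simp only [vecMul_smul, vecMul_vecMulVec] at this
    rw [dotProduct_comm u x, hu, one_smul, dotProduct_comm] at this
    rw [mul_smul, this]

/-! ### Words -/

section Words

variable {N : ℕ} {X : Fin N → Mat F n}

theorem mem_submodule_segre_iff {Y : Mat F n} (hY : Y ≠ 0) (z : SegrePoint F n) :
    Y ∈ (segre z).submodule ↔ Projectivization.mk F Y hY = segre z := by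
  constructor
  · intro h
    rw [Projectivization.submodule_eq, Submodule.mem_span_singleton] at h
    rw [← (segre z).mk_rep, Projectivization.mk_eq_mk_iff']
    exact h
  · rintro h
    rw [← h, Projectivization.submodule_mk]
    exact Submodule.mem_span_singleton_self _

theorem Represents.exists_mem (hX : Represents (longRootVariety F n) X) {z : SegrePoint F n}
    (hz : z ∈ flags F n) : ∃ i, (segre z).submodule = Submodule.span F {X i} := by
  obtain ⟨h0, -, hr⟩ := hX
  obtain ⟨i, hi⟩ : segre z ∈ Set.range fun i => Projectivization.mk F (X i) (h0 i) := by
    rw [hr]; exact ⟨z, hz, rfl⟩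
  exact ⟨i, by rw [← hi, Projectivization.submodule_mk]⟩

theorem Represents.exists_eq_vecMulVec (hX : Represents (longRootVariety F n) X) (i : Fin N) :
    ∃ x w : Fin (n + 1) → F, w ⬝ᵥ x = 0 ∧ X i = vecMulVec x w := by
  obtain ⟨h0, -, hr⟩ := hX
  obtain ⟨z, hz, e⟩ : Projectivization.mk F (X i) (h0 i) ∈ longRootVariety F n := by
    rw [← hr]; exact ⟨i, rfl⟩
  induction z using forall_segrePoint with | h x w hx hw =>
  rw [segre_mk hx hw, eq_comm, Projectivization.mk_eq_mk_iff'] at e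
  obtain ⟨a, ha⟩ := e
  refine ⟨a • x, w, ?_, by rw [← ha, smul_vecMulVec]⟩
  rw [dotProduct_smul, (mk_mem_flags hx hw).1 hz, smul_zero]

theorem wordHyperplane_codeword (hX : Represents (longRootVariety F n) X) (M : Mat F n) :
    wordHyperplane X (codeword X M) = plainHyperplane M := by
  refine Set.ext fun z => and_congr_right fun hz => ?_
  constructor
  · intro h Y hY
    obtain ⟨i, hi⟩ := hX.exists_mem hz
    rw [hi] at h hY
    obtain ⟨k, rfl⟩ := Submodule.mem_span_singleton.1 hY
    rw [smul_mul, trace_smul]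
    have : (X i * M).trace = 0 := h i (Submodule.mem_span_singleton_self _)
    rw [this, smul_zero]
  · exact fun h i hi => h _ hi

theorem exists_eq_trace_mul (f : Mat F n →ₗ[F] F) : ∃ M : Mat F n, ∀ Y, f Y = (Y * M).trace := by
  refine ⟨Matrix.of fun i j => f (Matrix.single j i 1), fun Y => ?_⟩
  conv_lhs => rw [matrix_eq_sum_single Y]
  simp only [map_sum, trace, diag, mul_apply, of_apply]
  refine Finset.sum_congr rfl fun a _ => Finset.sum_congr rfl fun b _ => ?_
  rw [← mul_one (Y a b), ← smul_eq_mul, ← smul_single, map_smul, smul_eq_mul, smul_eq_mul, mul_one]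

theorem mem_projectiveCode_iff {c : Fin N → F} :
    c ∈ projectiveCode F X ↔ ∃ M : Mat F n, c = codeword X M := by
  constructor
  · rintro ⟨m, rfl⟩
    obtain ⟨M, hM⟩ := exists_eq_trace_mul m
    exact ⟨M, funext fun i => hM (X i)⟩
  · rintro ⟨M, rfl⟩
    exact ⟨(traceLinearMap (Fin (n + 1)) F F) ∘ₗ LinearMap.mulRight F M, rfl⟩

/-- Each coordinate comes from a matrix of trace zero, on which scalar matrices give the value zero.
-/
theorem codeword_add_smul (hX : Represents (longRootVariety F n) X) (m l : F) (M : Mat F n) :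
    codeword X (m • (1 : Mat F n) + l • M) = l • codeword X M := by
  funext i
  obtain ⟨x, w, h, e⟩ := hX.exists_eq_vecMulVec i
  simp only [codeword, Pi.smul_apply, e, trace_vecMulVec_mul, add_mulVec, smul_mulVec, one_mulVec,
    dotProduct_add, dotProduct_smul, h, smul_zero, zero_add]

theorem plainHyperplane_subset_of_support (hX : Represents (longRootVariety F n) X) {M M' : Mat F n}
    (h : Function.support (codeword X M') ⊆ Function.support (codeword X M)) :
    plainHyperplane M ⊆ plainHyperplane M' := by
  rw [← wordHyperplane_codeword hX, ← wordHyperplane_codeword hX]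
  intro z hz
  refine ⟨hz.1, fun i hi => ?_⟩
  by_contra hn
  exact h hn (hz.2 i hi)

theorem wordHyperplane_smul {a : F} (ha : a ≠ 0) (c : Fin N → F) :
    wordHyperplane X (a • c) = wordHyperplane X c := by
  refine Set.ext fun z => and_congr_right fun _ => forall₂_congr fun i _ => ?_
  rw [Pi.smul_apply, smul_eq_zero, or_iff_right ha]

/-- The Segre map is injective and `X` lists each point of its image once, so coordinates correspond
bijectively to flags, and the support to the flags off the hyperplane. -/
theorem hammingNorm_eq_ncard [DecidableEq F] (hX : Represents (longRootVariety F n) X)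
    (c : Fin N → F) : hammingNorm c = (flags F n \ wordHyperplane X c).ncard := by
  obtain ⟨h0, hinj, hr⟩ := id hX
  have hz : ∀ i, ∃ z ∈ flags F n, segre z = Projectivization.mk F (X i) (h0 i) := fun i => by
    have : Projectivization.mk F (X i) (h0 i) ∈ longRootVariety F n := by rw [← hr]; exact ⟨i, rfl⟩
    exact this
  choose f hf hfe using hz
  have hiff : ∀ i j, X j ∈ (segre (f i)).submodule ↔ j = i := fun i j => by
    rw [mem_submodule_segre_iff (h0 j), hfe]
    exact hinj.eq_iff
  have hfinj : Function.Injective f := fun i j h => by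
    rw [← hiff j i, ← h, hiff]
  have himg : flags F n \ wordHyperplane X c = f '' (Finset.univ.filter fun i => c i ≠ 0) := by
    ext z
    simp only [Set.mem_sdiff, Set.mem_image, Finset.coe_filter, Finset.mem_univ, true_and,
      Set.mem_ofPred_eq]
    constructor
    · rintro ⟨hz, hw⟩
      have : ∃ i, X i ∈ (segre z).submodule ∧ c i ≠ 0 := by
        by_contra! hc
        exact hw ⟨hz, hc⟩
      obtain ⟨i, hi, hci⟩ := this
      refine ⟨i, hci, segre_injective ?_⟩
      rw [hfe, ← mem_submodule_segre_iff]
      exact hi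
    · rintro ⟨i, hci, rfl⟩
      exact ⟨hf i, fun h => hci (h.2 i ((hiff i i).2 rfl))⟩
  rw [himg, Set.ncard_image_of_injective _ hfinj, Set.ncard_coe_finset]
  rfl

end Words

/-! ### Weights -/

/-- Every pair of projective points has `(q - 1) ^ 2` pairs of vector representatives, so flags may
be counted with vectors. -/
theorem ncard_segrePoint_mul [Finite F] (Q : Set (SegrePoint F n)) :
    Q.ncard * ((Nat.card F - 1) * (Nat.card F - 1)) =
      {y : Vec F n × CoVec F n | ∃ (hx : y.1 ≠ 0) (hw : y.2 ≠ 0),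
        (Projectivization.mk F y.1 hx, Projectivization.mk F y.2 hw) ∈ Q}.ncard := by
  have hu : (Set.univ : Set Fˣ).ncard = Nat.card F - 1 := by
    rw [Set.ncard_univ, Nat.card_units]
  rw [← hu, ← Set.ncard_prod, ← Set.ncard_prod]
  let f : SegrePoint F n × Fˣ × Fˣ → Vec F n × CoVec F n :=
    fun t => (t.2.1 • t.1.1.rep, t.2.2 • t.1.2.rep)
  have hmk : ∀ (a : Fˣ) (p : Projectivization F (Fin (n + 1) → F)) (h : a • p.rep ≠ 0),
      Projectivization.mk F (a • p.rep) h = p := fun a p h => by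
    conv_rhs => rw [← p.mk_rep]
    exact (Projectivization.mk_eq_mk_iff F _ _ _ _).2 ⟨a, rfl⟩
  have hne : ∀ (a : Fˣ) (p : Projectivization F (Fin (n + 1) → F)), a • p.rep ≠ 0 := fun a p =>
    (smul_ne_zero_iff_ne a).2 p.rep_nonzero
  have hcan : ∀ (a b : Fˣ) (p : Projectivization F (Fin (n + 1) → F)), a • p.rep = b • p.rep →
      a = b := fun a b p h => Units.ext (smul_left_injective F p.rep_nonzero h)
  have hf : Function.Injective f := by
    rintro ⟨⟨p, A⟩, a, b⟩ ⟨⟨p', A'⟩, a', b'⟩ h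
    have h1 : a • p.rep = a' • p'.rep := congrArg Prod.fst h
    have h2 : b • A.rep = b' • A'.rep := congrArg Prod.snd h
    obtain rfl : p = p' := by
      rw [← hmk a p (hne a p), ← hmk a' p' (hne a' p')]; simp only [h1]
    obtain rfl : A = A' := by
      rw [← hmk b A (hne b A), ← hmk b' A' (hne b' A')]; simp only [h2]
    rw [hcan _ _ _ h1, hcan _ _ _ h2]
  rw [← Set.ncard_image_of_injective _ hf]
  congr 1
  ext ⟨x, w⟩
  simp only [Set.mem_image, Set.mem_prod, Set.mem_univ, and_true, Set.mem_ofPred_eq]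
  constructor
  · rintro ⟨⟨⟨p, A⟩, a, b⟩, hQ, e⟩
    obtain ⟨rfl, rfl⟩ := Prod.mk.inj e
    refine ⟨hne a p, hne b A, ?_⟩
    rw [hmk, hmk]
    exact hQ
  · rintro ⟨hx, hw, hQ⟩
    obtain ⟨a, ha⟩ := Projectivization.exists_smul_eq_mk_rep F x hx
    obtain ⟨b, hb⟩ := Projectivization.exists_smul_eq_mk_rep F w hw
    refine ⟨⟨_, a⁻¹, b⁻¹⟩, hQ, Prod.ext ?_ ?_⟩
    · change a⁻¹ • (Projectivization.mk F x hx).rep = x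
      rw [← ha, inv_smul_smul]
    · change b⁻¹ • (Projectivization.mk F w hw).rep = w
      rw [← hb, inv_smul_smul]

theorem card_filter_dotProduct [Fintype F] [DecidableEq F] (hn : 1 ≤ n) {x y : Fin (n + 1) → F}
    (hx : x ≠ 0) (hy : y ∉ Submodule.span F {x}) :
    (Finset.univ.filter fun w : Fin (n + 1) → F => w ⬝ᵥ x = 0 ∧ w ⬝ᵥ y ≠ 0).card =
      Nat.card F ^ (n - 1) * (Nat.card F - 1) := by
  have hy0 : y ≠ 0 := fun h => hy (h ▸ Submodule.zero_mem _)
  obtain ⟨w, hw, hwy⟩ := exists_dotProduct_ne_zero hy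
  have hwx := hw x (Submodule.mem_span_singleton_self x)
  -- Two distinct hyperplanes span the whole space, so they meet in dimension `n - 1`.
  have hlt : dotKer y < dotKer x ⊔ dotKer y := right_lt_sup.2 fun hle =>
    hwy (by
      have : w ∈ dotKer x := by rw [mem_dotKer, dotProduct_comm, hwx]
      rw [dotProduct_comm]; exact hle this)
  have h1 := Submodule.finrank_lt_finrank_of_lt hlt
  have h2 := Submodule.finrank_le (dotKer x ⊔ dotKer y)
  have h3 := Submodule.finrank_sup_add_finrank_inf_eq (dotKer x) (dotKer y)
  rw [finrank_dotKer hx, finrank_dotKer hy0] at h3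
  rw [finrank_dotKer hy0] at h1
  rw [Module.finrank_fin_fun] at h2
  have h4 : Module.finrank F ↥(dotKer x ⊓ dotKer y) = n - 1 := by omega
  have e : ((Finset.univ.filter fun w : Fin (n + 1) → F => w ⬝ᵥ x = 0 ∧ w ⬝ᵥ y ≠ 0 :
      Finset (Fin (n + 1) → F)) : Set (Fin (n + 1) → F)) =
      (dotKer x : Set (Fin (n + 1) → F)) \ (dotKer x ⊓ dotKer y : Submodule F (Vec F n)) := by
    ext w
    simp only [Finset.coe_filter, Finset.mem_univ, true_and, Set.mem_ofPred_eq, Set.mem_sdiff,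
      SetLike.mem_coe, Submodule.mem_inf, mem_dotKer, dotProduct_comm w]
    tauto
  rw [← Set.ncard_coe_finset, e, Set.ncard_sdiff (SetLike.coe_subset_coe.2 inf_le_left)
    (Set.toFinite _), ncard_submodule, ncard_submodule, h4, finrank_dotKer hx, Nat.mul_sub, mul_one,
    ← pow_succ, Nat.sub_add_cancel hn]

/-- The weight of a word in terms of the eigenvectors of a matrix. -/
theorem card_sub_one_mul_ncard_flags_diff [Finite F] (hn : 1 ≤ n) (M : Mat F n) :
    (Nat.card F - 1) * (flags F n \ plainHyperplane M).ncard =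
      Nat.card F ^ (n - 1) * (Nat.card F ^ (n + 1) - (eigSet M).ncard) := by
  classical
  have := Fintype.ofFinite F
  have hq := two_le_natCard F
  have h := ncard_segrePoint_mul (flags F n \ plainHyperplane M)
  have e : {y : Vec F n × CoVec F n | ∃ (hx : y.1 ≠ 0) (hw : y.2 ≠ 0),
      (Projectivization.mk F y.1 hx, Projectivization.mk F y.2 hw) ∈
        flags F n \ plainHyperplane M} =
      ((Finset.univ.filter fun y : Vec F n × CoVec F n => y.2 ⬝ᵥ y.1 = 0 ∧ y.2 ⬝ᵥ M *ᵥ y.1 ≠ 0 :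
        Finset _) : Set (Vec F n × CoVec F n)) := by
    ext ⟨x, w⟩
    simp only [Set.mem_ofPred_eq, Set.mem_sdiff, mk_mem_plainHyperplane, mk_mem_flags,
      Finset.coe_filter, Finset.mem_univ, true_and]
    constructor
    · rintro ⟨hx, hw, h1, h2⟩
      exact ⟨h1, fun h3 => h2 ⟨h1, h3⟩⟩
    · rintro ⟨h1, h2⟩
      refine ⟨?_, ?_, h1, fun h3 => h2 h3.2⟩
      · rintro rfl
        exact h2 (by rw [mulVec_zero, dotProduct_zero])
      · rintro rfl
        exact h2 (zero_dotProduct _)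
  -- The fibre over `x` depends only on whether `x` is an eigenvector.
  have hfib : ∀ x : Vec F n,
      (Finset.univ.filter fun w : CoVec F n => w ⬝ᵥ x = 0 ∧ w ⬝ᵥ M *ᵥ x ≠ 0).card =
        if IsEigen M x then 0 else Nat.card F ^ (n - 1) * (Nat.card F - 1) := fun x => by
    split_ifs with hx
    · rw [Finset.card_eq_zero, Finset.filter_eq_empty_iff]
      exact fun w _ hw => hw.2 (isEigen_iff_forall_dotProduct.1 hx w hw.1)
    · refine card_filter_dotProduct hn ?_ fun hm => hx ?_
      · rintro rfl
        exact hx (zero_mem_eigSet M)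
      · obtain ⟨a, ha⟩ := Submodule.mem_span_singleton.1 hm
        exact ⟨a, ha.symm⟩
  have hc : (Finset.univ.filter fun x : Vec F n => ¬ IsEigen M x).card =
      Nat.card F ^ (n + 1) - (eigSet M).ncard := by
    have htot := Finset.card_filter_add_card_filter_not (s := (Finset.univ : Finset (Vec F n)))
      (fun x => IsEigen M x)
    have huniv : (Finset.univ : Finset (Vec F n)).card = Nat.card F ^ (n + 1) := by
      rw [Finset.card_univ, Fintype.card_fun, Fintype.card_fin, Nat.card_eq_fintype_card]
    have : (eigSet M).ncard = (Finset.univ.filter fun x => IsEigen M x).card := by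
      rw [← Set.ncard_coe_finset]; congr 1; ext; simp [eigSet]
    omega
  rw [e, Set.ncard_coe_finset, Finset.card_filter, Fintype.sum_prod_type] at h
  simp_rw [← Finset.card_filter, hfib] at h
  rw [Finset.sum_ite, Finset.sum_const_zero, zero_add, Finset.sum_const, hc, smul_eq_mul] at h
  refine Nat.eq_of_mul_eq_mul_right (show 0 < Nat.card F - 1 by omega) ?_
  rw [mul_comm (Nat.card F - 1), mul_assoc, h]
  ring

end Geometry

/-! ### Quasi-singular, singular and spread-type hyperplanes -/

section Hyperplanes

variable {F : Type*} [Field F] {n : ℕ}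

theorem finrank_span_pair {V : Type*} [AddCommGroup V] [Module F V] {x y : V} (hx : x ≠ 0)
    (hy : y ∉ Submodule.span F {x}) : Module.finrank F (Submodule.span F {x, y}) = 2 := by
  have hli : LinearIndependent F ![x, y] :=
    (LinearIndependent.pair_iff' hx).2 fun a e => hy (Submodule.mem_span_singleton.2 ⟨a, e⟩)
  have := finrank_span_eq_card hli
  rwa [Matrix.range_cons_cons_empty, Fintype.card_fin] at this

theorem exists_finrank_eq_two (hn : 1 ≤ n) (p p' : Projectivization F (Fin (n + 1) → F)) :
    ∃ U : Submodule F (Fin (n + 1) → F),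
      Module.finrank F U = 2 ∧ p.submodule ≤ U ∧ p'.submodule ≤ U := by
  classical
  induction p with | h x hx => induction p' with | h y hy =>
  simp only [Projectivization.submodule_mk, Submodule.span_singleton_le_iff_mem]
  by_cases h : y ∈ Submodule.span F {x}
  · obtain ⟨z, hz⟩ := exists_notMem_span (F := F) (n := n) {x} (by rw [Finset.card_singleton]; omega)
    rw [Finset.coe_singleton] at hz
    refine ⟨_, finrank_span_pair hx hz, Submodule.subset_span (by simp), ?_⟩
    exact Submodule.span_mono (by simp) h
  · exact ⟨_, finrank_span_pair hx h, Submodule.subset_span (by simp),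
      Submodule.subset_span (by simp)⟩

/-- Two points, even equal ones, lie on a common projective line once the dimension `n + 1` is at
least two, so sharing a component is enough. -/
theorem collinear_iff (hn : 1 ≤ n) {z y : SegrePoint F n} :
    Collinear z y ↔ z.1 = y.1 ∨ z.2 = y.2 := by
  constructor
  · rintro ⟨L, ⟨p, U, -, rfl⟩ | ⟨A, U, -, rfl⟩, hz, hy⟩
    · exact Or.inl (hz.1.trans hy.1.symm)
    · exact Or.inr (hz.2.trans hy.2.symm)
  · rintro (h | h)
    · obtain ⟨U, hU, h1, h2⟩ := exists_finrank_eq_two hn z.2 y.2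
      exact ⟨_, Or.inl ⟨y.1, U, hU, rfl⟩, ⟨h, h1⟩, ⟨rfl, h2⟩⟩
    · obtain ⟨U, hU, h1, h2⟩ := exists_finrank_eq_two hn z.1 y.1
      exact ⟨_, Or.inr ⟨y.2, U, hU, rfl⟩, ⟨h1, h⟩, ⟨h2, rfl⟩⟩

/-- Tracing `x u` against `v w` gives `(w ⬝ᵥ x) * (u ⬝ᵥ v)`. It vanishes when the flag `(x, u)` has
its hyperplane through `v` or its point on `w`, which is when `(v, u)` or `(x, w)` is a flag
collinear with it. -/
theorem quasiSingular_mk (hn : 1 ≤ n) {v w : Fin (n + 1) → F} (hv : v ≠ 0) (hw : w ≠ 0) :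
    quasiSingular (Projectivization.mk F v hv) (Projectivization.mk F w hw) =
      plainHyperplane (vecMulVec v w) := by
  have h1 : ∀ z : SegrePoint F n, z ∈ plainHyperplane (vecMulVec v w) ↔ z ∈ flags F n ∧
      (Incident (Projectivization.mk F v hv) z.2 ∨ Incident z.1 (Projectivization.mk F w hw)) := by
    intro z
    induction z using forall_segrePoint with | h x u hx hu =>
    rw [mk_mem_plainHyperplane, mk_mem_flags, vecMulVec_mulVec, op_smul_eq_smul, dotProduct_smul,
      smul_eq_mul, mul_eq_zero, or_comm]
    rfl
  ext z
  rw [h1]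
  refine and_congr_right fun hz => ?_
  simp only [collinear_iff hn]
  constructor
  · rintro ⟨y, hy, e | e, h | h⟩
    · left; rw [← e, ← h]; exact hz
    · left; rw [← e, h]; exact hy
    · right; rw [← e, h]; exact hy
    · right; rw [← e, ← h]; exact hz
  · rintro (h | h)
    · exact ⟨(Projectivization.mk F v hv, z.2), h, Or.inl rfl, Or.inr rfl⟩
    · exact ⟨(z.1, Projectivization.mk F w hw), h, Or.inr rfl, Or.inl rfl⟩

theorem isQuasiSingular_iff (hn : 1 ≤ n) {H : Set (SegrePoint F n)} :
    IsQuasiSingular H ↔ ∃ M : Mat F n, M.rank = 1 ∧ H = plainHyperplane M := by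
  constructor
  · rintro ⟨p, A, rfl⟩
    induction p with | h v hv => induction A with | h w hw =>
    exact ⟨_, rank_eq_one_iff_exists_vecMulVec.2 ⟨v, w, hv, hw, rfl⟩, quasiSingular_mk hn hv hw⟩
  · rintro ⟨M, hM, rfl⟩
    obtain ⟨v, w, hv, hw, rfl⟩ := rank_eq_one_iff_exists_vecMulVec.1 hM
    exact ⟨_, _, (quasiSingular_mk hn hv hw).symm⟩

theorem isSingular_iff (hn : 1 ≤ n) {H : Set (SegrePoint F n)} :
    IsSingular H ↔ ∃ M : Mat F n, M.rank = 1 ∧ M.trace = 0 ∧ H = plainHyperplane M := by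
  constructor
  · rintro ⟨p, A, h, rfl⟩
    induction p with | h v hv => induction A with | h w hw =>
    refine ⟨_, rank_eq_one_iff_exists_vecMulVec.2 ⟨v, w, hv, hw, rfl⟩, ?_,
      quasiSingular_mk hn hv hw⟩
    rw [trace_vecMulVec, dotProduct_comm]
    exact h
  · rintro ⟨M, hM, ht, rfl⟩
    obtain ⟨v, w, hv, hw, rfl⟩ := rank_eq_one_iff_exists_vecMulVec.1 hM
    rw [trace_vecMulVec, dotProduct_comm] at ht
    exact ⟨Projectivization.mk F v hv, Projectivization.mk F w hw, ht, (quasiSingular_mk hn hv hw).symm⟩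

/-! ### Diagonalizability of the matrices of rank one -/

/-- Since `w ⬝ᵥ v ≠ 0`, the eigenvector `v` completes a basis of the kernel of `w` to an eigenbasis
of the whole space. -/
theorem isDiagonalizable_of_rank_eq_one {M : Mat F n} (hM : M.rank = 1) (ht : M.trace ≠ 0) :
    IsDiagonalizable M := by
  obtain ⟨v, w, hv, hw, rfl⟩ := rank_eq_one_iff_exists_vecMulVec.1 hM
  rw [trace_vecMulVec, dotProduct_comm] at ht
  let b := Module.finBasisOfFinrankEq F (dotKer w) (finrank_dotKer hw)
  let B : Module.Basis (Fin (n + 1)) F (Fin (n + 1) → F) := Module.Basis.mkFinCons v b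
    (fun c x hx h => by
      have := congrArg (fun y => w ⬝ᵥ y) h
      simp only [dotProduct_add, dotProduct_smul, mem_dotKer.1 hx, add_zero, dotProduct_zero,
        smul_eq_mul] at this
      exact (mul_eq_zero.1 this).resolve_right ht)
    (fun z => ⟨-(w ⬝ᵥ z) / (w ⬝ᵥ v), by
      rw [mem_dotKer, dotProduct_add, dotProduct_smul, smul_eq_mul, div_mul_cancel₀ _ ht,
        add_neg_cancel]⟩)
  have hB : ⇑B = Fin.cons v (fun i => (b i : Vec F n)) := Module.Basis.coe_mkFinCons _ _ _ _
  let e := Pi.basisFun F (Fin (n + 1))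
  let P : GL (Fin (n + 1)) F := ⟨e.toMatrix B, B.toMatrix e, e.toMatrix_mul_toMatrix_flip B,
    B.toMatrix_mul_toMatrix_flip e⟩
  have hcol : ∀ j c, (P : Mat F n) *ᵥ Pi.single j c = c • B j := fun j c => by
    rw [mulVec_single, op_smul_eq_smul]; rfl
  let d : Fin (n + 1) → F := Fin.cons (w ⬝ᵥ v) 0
  refine ⟨P, d, ?_⟩
  have key : vecMulVec v w * (P : Mat F n) = (P : Mat F n) * diagonal d := by
    refine ext_of_mulVec_single fun j => ?_
    rw [← mulVec_mulVec, ← mulVec_mulVec, diagonal_mulVec_single, hcol, hcol, one_smul, mul_one,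
      vecMulVec_mulVec, op_smul_eq_smul, hB]
    refine Fin.cases ?_ (fun i => ?_) j
    · rfl
    · rw [Fin.cons_succ, mem_dotKer.1 (b i).2, zero_smul]
      exact (zero_smul F _).symm
  rw [← key, mul_assoc, ← Units.val_mul, mul_inv_cancel, Units.val_one, mul_one]

/-- Such a matrix has square zero, and a diagonal matrix of square zero is zero. -/
theorem not_isDiagonalizable_of_rank_eq_one {M : Mat F n} (hM : M.rank = 1) (ht : M.trace = 0) :
    ¬ IsDiagonalizable M := by
  rintro ⟨P, d, hP⟩
  have hsq : M * M = 0 := by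
    obtain ⟨v, w, hv, hw, rfl⟩ := rank_eq_one_iff_exists_vecMulVec.1 hM
    rw [trace_vecMulVec, dotProduct_comm] at ht
    rw [vecMulVec_mul_vecMulVec, ht, zero_smul, vecMulVec_zero]
  have hD : diagonal d = ((P⁻¹ : GL (Fin (n + 1)) F) : Mat F n) * M * (P : Mat F n) := by
    rw [hP, mul_assoc, mul_assoc, mul_assoc, ← Units.val_mul, inv_mul_cancel, Units.val_one, mul_one,
      ← mul_assoc, ← Units.val_mul, inv_mul_cancel, Units.val_one, one_mul]
  have hDD : diagonal d * diagonal d = 0 := by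
    have : diagonal d * diagonal d = ((P⁻¹ : GL (Fin (n + 1)) F) : Mat F n) * (M *
        ((P : Mat F n) * ((P⁻¹ : GL (Fin (n + 1)) F) : Mat F n)) * M) * (P : Mat F n) := by
      rw [hD]; simp only [mul_assoc]
    rw [this, ← Units.val_mul, mul_inv_cancel, Units.val_one, mul_one, hsq, mul_zero, zero_mul]
  have hd : d = 0 := by
    rw [diagonal_mul_diagonal, diagonal_eq_zero] at hDD
    exact funext fun i => mul_self_eq_zero.1 (congrFun hDD i)
  rw [hP, hd, Pi.zero_def, diagonal_zero, mul_zero, zero_mul, rank_zero] at hM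
  exact zero_ne_one hM

/-! ### Matrices without eigenvalues -/

theorem hasNoEigenvalue_iff {M : Mat F n} : HasNoEigenvalue M ↔ eigSet M = {0} := by
  constructor
  · intro h
    refine Set.eq_singleton_iff_unique_mem.2 ⟨zero_mem_eigSet M, ?_⟩
    rintro x ⟨a, ha⟩
    by_contra hx
    exact h a (Module.End.hasEigenvalue_of_hasEigenvector
      ⟨Module.End.mem_eigenspace_iff.2 ha, hx⟩)
  · intro h a ha
    obtain ⟨x, hx, hx0⟩ := ha.exists_hasEigenvector
    have : x ∈ eigSet M := ⟨a, Module.End.mem_eigenspace_iff.1 hx⟩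
    rw [h] at this
    exact hx0 this

theorem hasNoEigenvalue_iff_ncard [Finite F] {M : Mat F n} :
    HasNoEigenvalue M ↔ (eigSet M).ncard = 1 := by
  rw [hasNoEigenvalue_iff, Set.ncard_eq_one]
  constructor
  · exact fun h => ⟨0, h⟩
  · rintro ⟨a, ha⟩
    have h0 := zero_mem_eigSet M
    rw [ha] at h0 ⊢
    rw [Set.mem_singleton_iff.1 h0]

/-- Multiplication by an element `a` of the extension field of degree `n + 1` works if `a` is not in
`F`: `a * y = c * y` with `y ≠ 0` would give `a = c`. -/
theorem exists_hasNoEigenvalue [Finite F] (hn : 1 ≤ n) : ∃ M : Mat F n, HasNoEigenvalue M := by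
  obtain ⟨p, hp⟩ := CharP.exists F
  have : Fact p.Prime := ⟨CharP.char_is_prime F p⟩
  let E := FiniteField.Extension F p (n + 1)
  have hE : Module.finrank F E = n + 1 := FiniteField.finrank_extension F p (n + 1)
  let b := Module.finBasisOfFinrankEq F E hE
  obtain ⟨a, ha⟩ : ∃ a : E, a ∉ Set.range (algebraMap F E) := by
    by_contra! h
    have : Module.finrank F E = 1 := finrank_eq_one_iff'.2
      ⟨1, one_ne_zero, fun y => by
        obtain ⟨c, hc⟩ := h y
        exact ⟨c, by rw [← hc, Algebra.algebraMap_eq_smul_one]⟩⟩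
    omega
  refine ⟨Algebra.leftMulMatrix b a, hasNoEigenvalue_iff.2
    (Set.eq_singleton_iff_unique_mem.2 ⟨zero_mem_eigSet _, ?_⟩)⟩
  rintro x ⟨c, hc⟩
  obtain ⟨y, rfl⟩ := b.equivFun.surjective x
  have h1 : Algebra.leftMulMatrix b a *ᵥ b.equivFun y = b.equivFun (a * y) :=
    Algebra.leftMulMatrix_mulVec_repr b a y
  rw [h1, ← map_smul, b.equivFun.injective.eq_iff, Algebra.smul_def, mul_eq_mul_right_iff] at hc
  rcases hc with hc | hc
  · exact absurd ⟨c, hc.symm⟩ ha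
  · rw [hc, map_zero]

theorem hasNoEigenvalue_transpose {M : Mat F n} (h : HasNoEigenvalue M) : HasNoEigenvalue Mᵀ := by
  rw [hasNoEigenvalue_iff] at h ⊢
  refine Set.eq_singleton_iff_unique_mem.2 ⟨zero_mem_eigSet _, ?_⟩
  rintro w ⟨a, ha⟩
  by_contra hw
  have h1 : ∃ v ≠ 0, v ᵥ* (M - a • (1 : Mat F n)) = 0 :=
    ⟨w, hw, by rw [vecMul_sub, vecMul_smul, vecMul_one, ← mulVec_transpose, ha, sub_self]⟩
  obtain ⟨x, hx, hx0⟩ := exists_mulVec_eq_zero_iff.2 (exists_vecMul_eq_zero_iff.1 h1)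
  have : x ∈ eigSet M := ⟨a, by rwa [sub_mulVec, smul_mulVec, one_mulVec, sub_eq_zero] at hx0⟩
  rw [h] at this
  exact hx this

/-! ### Spread-type hyperplanes -/

/-- If `x` were an eigenvector, all flags on `[x]` would lie in the hyperplane, so every `w`
vanishing at `x` would vanish on the spread line through `[x]`. A functional separating a second
point of that line from `x` contradicts this. -/
theorem hasNoEigenvalue_of_isSpreadType {M : Mat F n} (h : IsSpreadType (plainHyperplane M)) :
    HasNoEigenvalue M := by
  obtain ⟨S, T, ⟨⟨hS, hSu⟩, -, -⟩, hH⟩ := h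
  rw [hasNoEigenvalue_iff]
  refine Set.eq_singleton_iff_unique_mem.2 ⟨zero_mem_eigSet _, fun x hx => ?_⟩
  by_contra hx0
  replace hx0 : x ≠ 0 := hx0
  obtain ⟨l, ⟨hl, hxl⟩, hu⟩ := hSu (Projectivization.mk F x hx0) le_top
  have hlx : ¬ l ≤ Submodule.span F {x} := fun hle => by
    have := Submodule.finrank_mono hle
    rw [(hS l hl).1, finrank_span_singleton hx0] at this
    omega
  obtain ⟨y, hyl, hyx⟩ := SetLike.not_le_iff_exists.1 hlx
  obtain ⟨w, hw, hwy⟩ := exists_dotProduct_ne_zero hyx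
  have hwx := hw x (Submodule.mem_span_singleton_self x)
  have hw0 : w ≠ 0 := fun h0 => hwy (by rw [h0, zero_dotProduct])
  have hmem : (Projectivization.mk F x hx0, Projectivization.mk F w hw0) ∈ plainHyperplane M :=
    (mk_mem_plainHyperplane hx0 hw0 M).2 ⟨hwx, isEigen_iff_forall_dotProduct.1 hx w hwx⟩
  rw [hH] at hmem
  obtain ⟨-, l', hl', hxl', hann⟩ := hmem
  rw [hu l' ⟨hl', hxl'⟩, Projectivization.submodule_mk] at hann
  exact hwy (hann hyl w (Submodule.mem_span_singleton_self w))

/-- A maximal proper subspace of the trace-zero matrices is cut out by a functional on all matrices,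
which is `Y ↦ Tr(Y * M)` for some `M`. -/
theorem ArisesFromSegre.exists_eq_plainHyperplane {H : Set (SegrePoint F n)}
    (h : ArisesFromSegre H) : ∃ M : Mat F n, H = plainHyperplane M := by
  obtain ⟨W, hW, rfl, -⟩ := h
  obtain ⟨Y, hY, hYW⟩ := SetLike.exists_of_lt hW.lt
  obtain ⟨f, hfY, hf⟩ := Submodule.exists_le_ker_of_notMem hYW
  have hker : LinearMap.ker f ⊓ traceZero F n = W := by
    refine ((hW.eq_or_eq (le_inf hf hW.le) inf_le_right).resolve_right fun e => hfY ?_)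
    have : Y ∈ LinearMap.ker f ⊓ traceZero F n := by rwa [e]
    exact this.1
  obtain ⟨M, hM⟩ := exists_eq_trace_mul f
  refine ⟨M, Set.ext fun z => and_congr_right fun hz => ?_⟩
  have htz : (segre z).submodule ≤ traceZero F n := by
    induction z using forall_segrePoint with | h x w hx hw =>
    rw [segre_mk hx hw, Projectivization.submodule_mk, Submodule.span_singleton_le_iff_mem]
    change (vecMulVec x w).trace = 0
    rw [trace_vecMulVec, dotProduct_comm]
    exact (mk_mem_flags hx hw).1 hz
  rw [← hker, le_inf_iff, and_iff_left htz]
  exact forall₂_congr fun Y _ => by rw [LinearMap.mem_ker, hM]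

/-- The lines joining the points to their images. -/
def imageLines (M : Mat F n) : Set (Submodule F (Vec F n)) :=
  {l | ∃ x : Vec F n, x ≠ 0 ∧ l = Submodule.span F {x, M *ᵥ x}}

theorem mulVec_mem_of_mem_imageLines {M : Mat F n} {a b : F}
    (hsq : M * M = a • M + b • (1 : Mat F n)) {l : Submodule F (Vec F n)} (hl : l ∈ imageLines M)
    {x : Vec F n} (hx : x ∈ l) : M *ᵥ x ∈ l := by
  obtain ⟨y, hy, rfl⟩ := hl
  obtain ⟨c, d, rfl⟩ := Submodule.mem_span_pair.1 hx
  refine Submodule.mem_span_pair.2 ⟨d * b, c + d * a, ?_⟩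
  rw [mulVec_add, mulVec_smul, mulVec_smul, mulVec_mulVec, hsq, add_mulVec, smul_mulVec,
    smul_mulVec, one_mulVec]
  module

/-- Without eigenvectors the span of `x` and `M *ᵥ x` has dimension two, and the quadratic relation
makes each such line invariant. A line of the family through `x` thus contains `M *ᵥ x` and is
determined by `x`. The invariant subspace `U` allows use both for the whole space and for the
members of the dual spread. -/
theorem isLineSpread_imageLines {M : Mat F n} {a b : F}
    (hsq : M * M = a • M + b • (1 : Mat F n)) (hM : HasNoEigenvalue M)
    {U : Submodule F (Vec F n)} (hU : ∀ x ∈ U, M *ᵥ x ∈ U) :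
    IsLineSpread U {l | l ∈ imageLines M ∧ l ≤ U} := by
  rw [hasNoEigenvalue_iff] at hM
  have hfin : ∀ x : Vec F n, x ≠ 0 →
      Module.finrank F (Submodule.span F {x, M *ᵥ x}) = 2 := fun x hx =>
    finrank_span_pair hx fun hm => by
      obtain ⟨c, hc⟩ := Submodule.mem_span_singleton.1 hm
      have : x ∈ eigSet M := ⟨c, hc.symm⟩
      rw [hM] at this
      exact hx this
  refine ⟨?_, fun p hp => ?_⟩
  · rintro l ⟨⟨x, hx, rfl⟩, hl⟩
    exact ⟨hfin x hx, hl⟩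
  · induction p with | h x hx =>
    rw [Projectivization.submodule_mk, Submodule.span_singleton_le_iff_mem] at hp
    simp only [Projectivization.submodule_mk, Submodule.span_singleton_le_iff_mem]
    refine ⟨Submodule.span F {x, M *ᵥ x},
      ⟨⟨⟨x, hx, rfl⟩, Submodule.span_le.2 ?_⟩, Submodule.subset_span (by simp)⟩, ?_⟩
    · rintro y (rfl | rfl)
      · exact hp
      · exact hU x hp
    · rintro l ⟨⟨hl, -⟩, hxl⟩
      have hle : Submodule.span F {x, M *ᵥ x} ≤ l := Submodule.span_le.2 (by
        rintro y (rfl | rfl)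
        · exact hxl
        · exact mulVec_mem_of_mem_imageLines hsq hl hxl)
      refine (Submodule.eq_of_le_of_finrank_eq hle ?_).symm
      obtain ⟨y, hy, rfl⟩ := hl
      rw [hfin x hx, hfin y hy]

theorem isLineSpread_top_imageLines {M : Mat F n} {a b : F}
    (hsq : M * M = a • M + b • (1 : Mat F n)) (hM : HasNoEigenvalue M) :
    IsLineSpread ⊤ (imageLines M) := by
  have := isLineSpread_imageLines hsq hM (U := ⊤) fun _ _ => trivial
  simp only [le_top, and_true] at this
  exact this

/-- The dual spread consists of the lines of `Mᵀ`: their annihilators are `M`-invariant, hence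
partitioned by lines of `M`. A flag `(x, w)` is in the hyperplane when `w` kills both `x` and `M *ᵥ
x`, that is, the spread line of `x`. -/
theorem isSpreadType_of_mul_self_eq {M : Mat F n} {a b : F}
    (hsq : M * M = a • M + b • (1 : Mat F n)) (hM : HasNoEigenvalue M) :
    IsSpreadType (plainHyperplane M) := by
  have hsqt : Mᵀ * Mᵀ = a • Mᵀ + b • (1 : Mat F n) := by
    rw [← transpose_mul, hsq, transpose_add, transpose_smul, transpose_smul, transpose_one]
  refine ⟨imageLines M, imageLines Mᵀ, ⟨isLineSpread_top_imageLines hsq hM,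
    isLineSpread_top_imageLines hsqt (hasNoEigenvalue_transpose hM), fun m hm =>
      isLineSpread_imageLines hsq hM fun x hx w hw => ?_⟩, Set.ext fun z => ?_⟩
  · have := hx _ (mulVec_mem_of_mem_imageLines hsqt hm hw)
    rwa [mulVec_transpose, ← dotProduct_mulVec] at this
  · induction z using forall_segrePoint with | h x w hx hw =>
    simp only [mk_mem_plainHyperplane, Set.mem_ofPred_eq, mk_mem_flags, Projectivization.submodule_mk,
      Submodule.span_singleton_le_iff_mem]
    refine and_congr_right fun h0 => ?_
    constructor
    · intro h1
      refine ⟨_, ⟨x, hx, rfl⟩, Submodule.subset_span (by simp), Submodule.span_le.2 ?_⟩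
      rintro y (rfl | rfl) u hu
      · obtain ⟨c, rfl⟩ := Submodule.mem_span_singleton.1 hu
        rw [smul_dotProduct, h0, smul_zero]
      · obtain ⟨c, rfl⟩ := Submodule.mem_span_singleton.1 hu
        rw [smul_dotProduct, h1, smul_zero]
    · rintro ⟨l, hl, hxl, hann⟩
      exact hann (mulVec_mem_of_mem_imageLines hsq hl hxl) w (Submodule.mem_span_singleton_self w)

theorem exists_mul_self_eq_of_natDegree_minpoly {M : Mat F n} (h : (minpoly F M).natDegree = 2) :
    ∃ a b : F, M * M = a • M + b • (1 : Mat F n) := by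
  have hmon : (minpoly F M).coeff 2 = 1 := by
    have := minpoly.monic (Algebra.IsIntegral.isIntegral (R := F) M)
    rwa [Polynomial.Monic, Polynomial.leadingCoeff, h] at this
  have h0 := minpoly.aeval F M
  rw [Polynomial.aeval_eq_sum_range, h, Finset.sum_range_succ, Finset.sum_range_succ,
    Finset.sum_range_one, hmon, one_smul, pow_zero, pow_one, pow_two] at h0
  refine ⟨-(minpoly F M).coeff 1, -(minpoly F M).coeff 0, ?_⟩
  rw [eq_neg_of_add_eq_zero_right h0]
  module

end Hyperplanes

/-! ### The weight spectrum and minimality of the code -/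

section Weights

variable {F : Type*} [Field F] [Fintype F] {n N : ℕ} {X : Fin N → Mat F n}

theorem ncard_eigSet_le (M : Mat F n) : (eigSet M).ncard ≤ Fintype.card F ^ (n + 1) := by
  rw [← Fintype.card_fin (n + 1), ← Fintype.card_fun, ← Nat.card_eq_fintype_card, ← Set.ncard_univ]
  exact Set.ncard_le_ncard (Set.subset_univ _) (Set.toFinite _)

theorem one_le_ncard_eigSet (M : Mat F n) : 1 ≤ (eigSet M).ncard :=
  (Set.ncard_pos (Set.toFinite _)).2 ⟨0, zero_mem_eigSet M⟩

variable [DecidableEq F]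

theorem card_sub_one_mul_hammingNorm (hn : 1 ≤ n) (hX : Represents (longRootVariety F n) X)
    (M : Mat F n) : (Fintype.card F - 1) * hammingNorm (codeword X M) =
      Fintype.card F ^ (n - 1) * (Fintype.card F ^ (n + 1) - (eigSet M).ncard) := by
  rw [hammingNorm_eq_ncard hX, wordHyperplane_codeword hX, ← Nat.card_eq_fintype_card,
    card_sub_one_mul_ncard_flags_diff hn]

/-- The weight of a word is a decreasing function of the number of eigenvectors. -/
theorem hammingNorm_codeword_le_iff (hn : 1 ≤ n) (hX : Represents (longRootVariety F n) X)
    (M : Mat F n) {e k : ℕ} (he : e ≤ Fintype.card F ^ (n + 1))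
    (hk : (Fintype.card F - 1) * k = Fintype.card F ^ (n - 1) * (Fintype.card F ^ (n + 1) - e)) :
    (hammingNorm (codeword X M) ≤ k ↔ e ≤ (eigSet M).ncard) ∧
      (k ≤ hammingNorm (codeword X M) ↔ (eigSet M).ncard ≤ e) ∧
      (hammingNorm (codeword X M) = k ↔ (eigSet M).ncard = e) := by
  have hw := card_sub_one_mul_hammingNorm hn hX M
  have hq : 2 ≤ Fintype.card F := Fintype.one_lt_card
  have hp : 0 < Fintype.card F ^ (n - 1) := Nat.pow_pos (by omega)
  have hle := ncard_eigSet_le M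
  have h1 : hammingNorm (codeword X M) ≤ k ↔ e ≤ (eigSet M).ncard := by
    rw [← Nat.mul_le_mul_left_iff (show 0 < Fintype.card F - 1 by omega), hw, hk,
      Nat.mul_le_mul_left_iff hp]
    omega
  have h2 : k ≤ hammingNorm (codeword X M) ↔ (eigSet M).ncard ≤ e := by
    rw [← Nat.mul_le_mul_left_iff (show 0 < Fintype.card F - 1 by omega), hw, hk,
      Nat.mul_le_mul_left_iff hp]
    omega
  exact ⟨h1, h2, by rw [le_antisymm_iff, le_antisymm_iff, h1, h2, and_comm]⟩

theorem pow_add_sub_one_le {q : ℕ} (hn : 1 ≤ n) (hq : 2 ≤ q) : q ^ n + (q - 1) ≤ q ^ (n + 1) := by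
  have h1 : q ^ 1 ≤ q ^ n := Nat.pow_le_pow_right (by omega) hn
  have h2 : 2 * q ^ n ≤ q ^ (n + 1) := by
    rw [pow_succ, mul_comm]; exact Nat.mul_le_mul_left _ hq
  rw [pow_one] at h1
  omega

theorem sub_one_mul_minWeight {q : ℕ} (hn : 1 ≤ n) (hq : 2 ≤ q) :
    (q - 1) * (q ^ (2 * n - 1) - q ^ (n - 1)) =
      q ^ (n - 1) * (q ^ (n + 1) - (q ^ n + (q - 1))) := by
  obtain ⟨m, rfl⟩ := Nat.exists_eq_add_of_le hn
  obtain ⟨r, rfl⟩ := Nat.exists_eq_add_of_le hq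
  have h1 := pow_add_sub_one_le hn hq
  have e1 : 2 * (1 + m) - 1 = m + (m + 1) := by omega
  have e2 : 1 + m - 1 = m := by omega
  have e3 : 2 + r - 1 = 1 + r := by omega
  rw [e3] at h1
  rw [e1, e2, e3]
  have h2 : (2 + r) ^ m ≤ (2 + r) ^ (m + (m + 1)) := Nat.pow_le_pow_right (by omega) (by omega)
  zify [h1, h2]
  ring

theorem sub_one_mul_secondWeight {q : ℕ} (hn : 1 ≤ n) :
    (q - 1) * q ^ (2 * n - 1) = q ^ (n - 1) * (q ^ (n + 1) - q ^ n) := by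
  have e : 2 * n - 1 = n - 1 + n := by omega
  rw [e, pow_add, pow_succ q n, ← Nat.mul_sub_one]
  ring

theorem sub_one_mul_maxWeight {q : ℕ} :
    (q - 1) * (q ^ (n - 1) * (q ^ (n + 1) - 1) / (q - 1)) = q ^ (n - 1) * (q ^ (n + 1) - 1) :=
  Nat.mul_div_cancel' (Dvd.dvd.mul_left (Nat.sub_one_dvd_pow_sub_one q (n + 1)) _)

theorem minWeight_lt_secondWeight {q : ℕ} (hq : 2 ≤ q) :
    q ^ (2 * n - 1) - q ^ (n - 1) < q ^ (2 * n - 1) := by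
  have h1 : 0 < q ^ (n - 1) := Nat.pow_pos (by omega)
  have h2 : 0 < q ^ (2 * n - 1) := Nat.pow_pos (by omega)
  omega

theorem minWeight_pos {q : ℕ} (hn : 1 ≤ n) (hq : 2 ≤ q) : 0 < q ^ (2 * n - 1) - q ^ (n - 1) :=
  Nat.sub_pos_of_lt (Nat.pow_lt_pow_right (by omega) (by omega))

/-- Weight zero means that every vector is an eigenvector, which characterizes the scalar matrices.
-/
theorem codeword_eq_zero_iff (hn : 1 ≤ n) (hX : Represents (longRootVariety F n) X) {M : Mat F n} :
    codeword X M = 0 ↔ ∃ a : F, M = a • (1 : Mat F n) := by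
  have hu : Fintype.card F ^ (n + 1) = (Set.univ : Set (Vec F n)).ncard := by
    rw [Set.ncard_univ, Nat.card_eq_fintype_card, Fintype.card_fun, Fintype.card_fin]
  rw [← hammingNorm_eq_zero, (hammingNorm_codeword_le_iff hn hX M (e := Fintype.card F ^ (n + 1))
    (k := 0) le_rfl (by simp)).2.2, ← eigSet_eq_univ_iff, hu]
  exact ⟨fun h => Set.eq_of_subset_of_ncard_le (Set.subset_univ _) h.ge (Set.toFinite _),
    fun h => by rw [h]⟩

omit [DecidableEq F] in
theorem ncard_eigSet_of_rank_eq_one_of_trace_ne_zero {M : Mat F n} (hM : M.rank = 1)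
    (ht : M.trace ≠ 0) : (eigSet M).ncard = Fintype.card F ^ n + (Fintype.card F - 1) := by
  obtain ⟨v, w, hv, hw, rfl⟩ := rank_eq_one_iff_exists_vecMulVec.1 hM
  rw [trace_vecMulVec, dotProduct_comm] at ht
  have h := ncard_eigSet_of_dotProduct_ne_zero hv hw ht 0
  rw [zero_smul, zero_add, Nat.card_eq_fintype_card] at h
  have : 2 ≤ Fintype.card F := Fintype.one_lt_card
  omega

omit [DecidableEq F] in
theorem ncard_eigSet_of_rank_eq_one_of_trace_eq_zero {M : Mat F n} (hM : M.rank = 1)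
    (ht : M.trace = 0) : (eigSet M).ncard = Fintype.card F ^ n := by
  obtain ⟨v, w, hv, hw, rfl⟩ := rank_eq_one_iff_exists_vecMulVec.1 hM
  rw [trace_vecMulVec, dotProduct_comm] at ht
  have h := ncard_eigSet_of_dotProduct_eq_zero hv hw ht 0
  rwa [zero_smul, zero_add, Nat.card_eq_fintype_card] at h

omit [Fintype F] [DecidableEq F] in
theorem codeword_smul_one_add (hX : Represents (longRootVariety F n) X) (a : F) (M : Mat F n) :
    codeword X (a • (1 : Mat F n) + M) = codeword X M := by
  rw [← one_smul F M, codeword_add_smul hX, one_smul, one_smul]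

theorem hammingNorm_of_trace_ne_zero (hn : 1 ≤ n) (hX : Represents (longRootVariety F n) X)
    {M : Mat F n} (hM : M.rank = 1) (ht : M.trace ≠ 0) : hammingNorm (codeword X M) =
      Fintype.card F ^ (2 * n - 1) - Fintype.card F ^ (n - 1) :=
  (hammingNorm_codeword_le_iff hn hX M (pow_add_sub_one_le hn Fintype.one_lt_card)
    (sub_one_mul_minWeight hn Fintype.one_lt_card)).2.2.2
    (ncard_eigSet_of_rank_eq_one_of_trace_ne_zero hM ht)

theorem hammingNorm_of_trace_eq_zero (hn : 1 ≤ n) (hX : Represents (longRootVariety F n) X)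
    {M : Mat F n} (hM : M.rank = 1) (ht : M.trace = 0) : hammingNorm (codeword X M) =
      Fintype.card F ^ (2 * n - 1) :=
  (hammingNorm_codeword_le_iff hn hX M (Nat.pow_le_pow_right Fintype.card_pos (Nat.le_succ n))
    (sub_one_mul_secondWeight hn)).2.2.2 (ncard_eigSet_of_rank_eq_one_of_trace_eq_zero hM ht)

/-- A nonzero word has the minimum weight, or the second lowest weight, or a larger one. -/
theorem hammingNorm_codeword_trichotomy (hn : 1 ≤ n) (hX : Represents (longRootVariety F n) X)
    {M : Mat F n} (hM : codeword X M ≠ 0) :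
    (∃ M₀ : Mat F n, M₀.rank = 1 ∧ M₀.trace ≠ 0 ∧ codeword X M = codeword X M₀) ∨
      (∃ M₀ : Mat F n, M₀.rank = 1 ∧ M₀.trace = 0 ∧ codeword X M = codeword X M₀) ∨
      Fintype.card F ^ (2 * n - 1) < hammingNorm (codeword X M) := by
  rw [Ne, codeword_eq_zero_iff hn hX, not_exists] at hM
  obtain ⟨a, v, w, hv, hw, h, e, -⟩ | ⟨a, v, w, hv, hw, h, e, -⟩ | h := ncard_eigSet_trichotomy hn hM
  · refine Or.inl ⟨vecMulVec v w, rank_eq_one_iff_exists_vecMulVec.2 ⟨v, w, hv, hw, rfl⟩, ?_, ?_⟩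
    · rwa [trace_vecMulVec, dotProduct_comm]
    · rw [e, codeword_smul_one_add hX]
  · refine Or.inr (Or.inl
      ⟨vecMulVec v w, rank_eq_one_iff_exists_vecMulVec.2 ⟨v, w, hv, hw, rfl⟩, ?_, ?_⟩)
    · rwa [trace_vecMulVec, dotProduct_comm]
    · rw [e, codeword_smul_one_add hX]
  · right; right
    rw [Nat.card_eq_fintype_card] at h
    rw [← not_le, (hammingNorm_codeword_le_iff hn hX M
      (Nat.pow_le_pow_right Fintype.card_pos (Nat.le_succ n)) (sub_one_mul_secondWeight hn)).1]
    exact h.not_ge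

theorem hammingNorm_eq_minWeight_iff (hn : 1 ≤ n) (hX : Represents (longRootVariety F n) X)
    {M : Mat F n} :
    hammingNorm (codeword X M) = Fintype.card F ^ (2 * n - 1) - Fintype.card F ^ (n - 1) ↔
      ∃ M₀ : Mat F n, M₀.rank = 1 ∧ M₀.trace ≠ 0 ∧ codeword X M = codeword X M₀ := by
  have hq : 2 ≤ Fintype.card F := Fintype.one_lt_card
  have hlt := minWeight_lt_secondWeight (n := n) hq
  constructor
  · intro h
    have h0 : codeword X M ≠ 0 := hammingNorm_pos_iff.1 (h ▸ minWeight_pos hn hq)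
    obtain h1 | ⟨M₀, hr, ht, e⟩ | h1 := hammingNorm_codeword_trichotomy hn hX h0
    · exact h1
    · rw [e, hammingNorm_of_trace_eq_zero hn hX hr ht] at h
      omega
    · omega
  · rintro ⟨M₀, hr, ht, e⟩
    rw [e, hammingNorm_of_trace_ne_zero hn hX hr ht]

theorem hammingNorm_eq_secondWeight_iff (hn : 1 ≤ n) (hX : Represents (longRootVariety F n) X)
    {M : Mat F n} :
    hammingNorm (codeword X M) = Fintype.card F ^ (2 * n - 1) ↔
      ∃ M₀ : Mat F n, M₀.rank = 1 ∧ M₀.trace = 0 ∧ codeword X M = codeword X M₀ := by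
  have hq : 2 ≤ Fintype.card F := Fintype.one_lt_card
  have hlt := minWeight_lt_secondWeight (n := n) hq
  constructor
  · intro h
    have h0 : codeword X M ≠ 0 := hammingNorm_pos_iff.1 (by omega)
    obtain ⟨M₀, hr, ht, e⟩ | h1 | h1 := hammingNorm_codeword_trichotomy hn hX h0
    · rw [e, hammingNorm_of_trace_ne_zero hn hX hr ht] at h
      omega
    · exact h1
    · omega
  · rintro ⟨M₀, hr, ht, e⟩
    rw [e, hammingNorm_of_trace_eq_zero hn hX hr ht]

theorem hammingNorm_eq_maxWeight_iff (hn : 1 ≤ n) (hX : Represents (longRootVariety F n) X)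
    {M : Mat F n} : hammingNorm (codeword X M) =
      Fintype.card F ^ (n - 1) * (Fintype.card F ^ (n + 1) - 1) / (Fintype.card F - 1) ↔
      HasNoEigenvalue M := by
  rw [(hammingNorm_codeword_le_iff hn hX M (Nat.one_le_pow _ _ Fintype.card_pos)
    sub_one_mul_maxWeight).2.2, hasNoEigenvalue_iff_ncard]

theorem hammingNorm_le_maxWeight (hn : 1 ≤ n) (hX : Represents (longRootVariety F n) X)
    (M : Mat F n) : hammingNorm (codeword X M) ≤
      Fintype.card F ^ (n - 1) * (Fintype.card F ^ (n + 1) - 1) / (Fintype.card F - 1) :=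
  (hammingNorm_codeword_le_iff hn hX M (Nat.one_le_pow _ _ Fintype.card_pos)
    sub_one_mul_maxWeight).1.2 (one_le_ncard_eigSet M)

theorem isLeast_weights (hn : 1 ≤ n) (hX : Represents (longRootVariety F n) X) :
    IsLeast (weights (projectiveCode F X))
      (Fintype.card F ^ (2 * n - 1) - Fintype.card F ^ (n - 1)) := by
  have hq : 2 ≤ Fintype.card F := Fintype.one_lt_card
  constructor
  -- The minimum is attained by the matrix unit at position `(0, 0)`.
  · have hv : (Pi.single 0 1 : Fin (n + 1) → F) ≠ 0 := Pi.single_ne_zero_iff.2 one_ne_zero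
    have hM := hammingNorm_of_trace_ne_zero hn hX
      (rank_eq_one_iff_exists_vecMulVec.2 ⟨_, _, hv, hv, rfl⟩)
      (by rw [trace_vecMulVec, single_dotProduct, Pi.single_eq_same, one_mul]; exact one_ne_zero)
    exact ⟨_, mem_projectiveCode_iff.2 ⟨_, rfl⟩,
      hammingNorm_pos_iff.1 (hM ▸ minWeight_pos hn hq), hM⟩
  · rintro _ ⟨c, hc, h0, rfl⟩
    obtain ⟨M, rfl⟩ := mem_projectiveCode_iff.1 hc
    have hlt := minWeight_lt_secondWeight (n := n) hq
    obtain ⟨M₀, hr, ht, e⟩ | ⟨M₀, hr, ht, e⟩ | h := hammingNorm_codeword_trichotomy hn hX h0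
    · rw [e, hammingNorm_of_trace_ne_zero hn hX hr ht]
    · rw [e, hammingNorm_of_trace_eq_zero hn hX hr ht]; exact hlt.le
    · exact (hlt.trans h).le

theorem isLeast_weights_gt (hn : 1 ≤ n) (hX : Represents (longRootVariety F n) X) :
    IsLeast {w | w ∈ weights (projectiveCode F X) ∧
      Fintype.card F ^ (2 * n - 1) - Fintype.card F ^ (n - 1) < w}
      (Fintype.card F ^ (2 * n - 1)) := by
  have hq : 2 ≤ Fintype.card F := Fintype.one_lt_card
  have hlt := minWeight_lt_secondWeight (n := n) hq
  constructor
  -- The second weight is attained by the off-diagonal matrix unit at position `(0, n)`.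
  · have hne : (0 : Fin (n + 1)) ≠ Fin.last n := fun h => by
      have := congrArg Fin.val h
      rw [Fin.val_last] at this
      exact absurd this.symm (by rw [Fin.val_zero]; omega)
    have hv : ∀ i : Fin (n + 1), (Pi.single i 1 : Fin (n + 1) → F) ≠ 0 := fun i =>
      Pi.single_ne_zero_iff.2 one_ne_zero
    have hM := hammingNorm_of_trace_eq_zero hn hX
      (rank_eq_one_iff_exists_vecMulVec.2 ⟨_, _, hv 0, hv (Fin.last n), rfl⟩)
      (by rw [trace_vecMulVec, single_dotProduct, Pi.single_eq_of_ne hne, mul_zero])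
    exact ⟨⟨_, mem_projectiveCode_iff.2 ⟨_, rfl⟩, hammingNorm_pos_iff.1 (by omega), hM⟩, hlt⟩
  · rintro _ ⟨⟨c, hc, h0, rfl⟩, hw⟩
    obtain ⟨M, rfl⟩ := mem_projectiveCode_iff.1 hc
    obtain ⟨M₀, hr, ht, e⟩ | ⟨M₀, hr, ht, e⟩ | h := hammingNorm_codeword_trichotomy hn hX h0
    · rw [e, hammingNorm_of_trace_ne_zero hn hX hr ht] at hw
      exact absurd hw (lt_irrefl _)
    · rw [e, hammingNorm_of_trace_eq_zero hn hX hr ht]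
    · exact h.le

theorem isGreatest_weights (hn : 1 ≤ n) (hX : Represents (longRootVariety F n) X) :
    IsGreatest (weights (projectiveCode F X))
      (Fintype.card F ^ (n - 1) * (Fintype.card F ^ (n + 1) - 1) / (Fintype.card F - 1)) := by
  constructor
  · obtain ⟨M, hM⟩ := exists_hasNoEigenvalue (F := F) hn
    refine ⟨_, mem_projectiveCode_iff.2 ⟨M, rfl⟩, ?_, (hammingNorm_eq_maxWeight_iff hn hX).2 hM⟩
    rw [Ne, codeword_eq_zero_iff hn hX, ← eigSet_eq_univ_iff, hasNoEigenvalue_iff.1 hM]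
    exact fun h => (Set.nontrivial_univ (α := Vec F n)).ne_singleton h.symm
  · rintro _ ⟨c, hc, -, rfl⟩
    obtain ⟨M, rfl⟩ := mem_projectiveCode_iff.1 hc
    exact hammingNorm_le_maxWeight hn hX M

theorem not_ashikhminBarg (hn : 1 ≤ n) (hX : Represents (longRootVariety F n) X) :
    ¬ AshikhminBarg (projectiveCode F X) := by
  have hq : 2 ≤ Fintype.card F := Fintype.one_lt_card
  have hmax := isGreatest_weights hn hX
  have hmin := isLeast_weights hn hX
  unfold AshikhminBarg
  rw [hmax.csSup_eq, hmin.csInf_eq, not_lt]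
  have e := sub_one_mul_maxWeight (n := n) (q := Fintype.card F)
  generalize Fintype.card F ^ (n - 1) * (Fintype.card F ^ (n + 1) - 1) / (Fintype.card F - 1) = W
    at e
  have hpos := minWeight_pos hn hq
  -- After taking out `q ^ (n - 1)`, this compares `q ^ (n + 1) - q` with `q ^ (n + 1) - 1`.
  have key : Fintype.card F * (Fintype.card F ^ (2 * n - 1) - Fintype.card F ^ (n - 1)) ≤
      (Fintype.card F - 1) * W := by
    have e1 : 2 * n - 1 = n - 1 + n := by omega
    rw [e, e1, pow_add, ← Nat.mul_sub_one, mul_left_comm, Nat.mul_sub_one, ← pow_succ']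
    exact Nat.mul_le_mul_left _ (by omega)
  generalize Fintype.card F ^ (2 * n - 1) - Fintype.card F ^ (n - 1) = w at key hpos
  have key' : (Fintype.card F : ℚ) * w ≤ ((Fintype.card F : ℚ) - 1) * W := by
    rw [← Nat.cast_one, ← Nat.cast_sub (by omega)]
    exact_mod_cast key
  have h1 : (0 : ℚ) < (Fintype.card F : ℚ) - 1 := by
    rw [sub_pos]; exact_mod_cast hq
  rw [div_le_div_iff₀ h1 (by exact_mod_cast hpos)]
  linarith

theorem isMinimalCode_projectiveCode (hn : 2 ≤ n) (hnq : ¬(n = 2 ∧ Fintype.card F = 2))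
    (hX : Represents (longRootVariety F n) X) : IsMinimalCode (projectiveCode F X) := by
  intro c hc c' hc' hs
  obtain ⟨M, rfl⟩ := mem_projectiveCode_iff.1 hc
  obtain ⟨M', rfl⟩ := mem_projectiveCode_iff.1 hc'
  by_cases h0 : codeword X M = 0
  · refine ⟨0, ?_⟩
    rw [h0, Function.support_zero, Set.subset_empty_iff, Function.support_eq_empty_iff] at hs
    rw [hs, zero_smul]
  · rw [codeword_eq_zero_iff (by omega) hX, not_exists] at h0
    obtain ⟨m, l, rfl⟩ := exists_eq_add_smul_of_forall_exists hn
      (by rwa [Nat.card_eq_fintype_card]) h0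
      (exists_eq_of_plainHyperplane_subset (plainHyperplane_subset_of_support hX hs))
    exact ⟨l, codeword_add_smul hX m l M⟩

omit [Fintype F] in
/-- The words defined by the matrices of rank one are determined by their hyperplanes up to
scalars. -/
theorem wordHyperplane_eq_iff_of_rank_eq_one (hX : Represents (longRootVariety F n) X)
    {M : Mat F n} (hM : M.rank = 1) (h0 : codeword X M ≠ 0) {c : Fin N → F}
    (hc : c ∈ projectiveCode F X) :
    wordHyperplane X c = wordHyperplane X (codeword X M) ↔ ∃ a : F, a ≠ 0 ∧ c = a • codeword X M := by
  obtain ⟨M', rfl⟩ := mem_projectiveCode_iff.1 hc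
  constructor
  · intro h
    obtain ⟨p, w, hp, hw, rfl⟩ := rank_eq_one_iff_exists_vecMulVec.1 hM
    -- The hyperplane determines the weight; this rules out the factor `l = 0` below.
    have hnorm : hammingNorm (codeword X M') = hammingNorm (codeword X (vecMulVec p w)) := by
      rw [hammingNorm_eq_ncard hX, h, ← hammingNorm_eq_ncard hX]
    rw [wordHyperplane_codeword hX, wordHyperplane_codeword hX] at h
    obtain ⟨m, l, rfl⟩ := exists_eq_add_smul_vecMulVec hp hw
      (exists_eq_of_plainHyperplane_subset h.ge) (fun x hx => eigSet_mono h.le hx)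
    refine ⟨l, ?_, codeword_add_smul hX m l _⟩
    rintro rfl
    rw [codeword_add_smul hX, zero_smul, hammingNorm_zero, eq_comm, hammingNorm_eq_zero] at hnorm
    exact h0 hnorm
  · rintro ⟨a, ha, e⟩
    rw [e, wordHyperplane_smul ha]

-- A hyperplane determines the eigenvectors of every matrix defining it, and `q ^ n + q - 1` differs
-- from `q ^ n`, so rank one matrices of zero and of nonzero trace never define the same hyperplane.
omit [DecidableEq F] in
theorem isQuasiSingular_and_not_isSingular_iff (hn : 1 ≤ n) {H : Set (SegrePoint F n)} :
    IsQuasiSingular H ∧ ¬ IsSingular H ↔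
      ∃ M : Mat F n, M.rank = 1 ∧ M.trace ≠ 0 ∧ H = plainHyperplane M := by
  rw [isQuasiSingular_iff hn, isSingular_iff hn]
  constructor
  · rintro ⟨⟨M, hr, e⟩, h⟩
    exact ⟨M, hr, fun ht => h ⟨M, hr, ht, e⟩, e⟩
  · rintro ⟨M, hr, ht, e⟩
    refine ⟨⟨M, hr, e⟩, ?_⟩
    rintro ⟨M', hr', ht', e'⟩
    have h1 := ncard_eigSet_of_rank_eq_one_of_trace_ne_zero hr ht
    rw [eigSet_eq_of_plainHyperplane_eq (e.symm.trans e'),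
      ncard_eigSet_of_rank_eq_one_of_trace_eq_zero hr' ht'] at h1
    have : 2 ≤ Fintype.card F := Fintype.one_lt_card
    omega

omit [Fintype F] in
theorem hammingNorm_eq_of_plainHyperplane_eq (hX : Represents (longRootVariety F n) X)
    {M M' : Mat F n} (h : plainHyperplane M = plainHyperplane M') :
    hammingNorm (codeword X M) = hammingNorm (codeword X M') := by
  rw [hammingNorm_eq_ncard hX, hammingNorm_eq_ncard hX, wordHyperplane_codeword hX,
    wordHyperplane_codeword hX, h]

end Weights

end PointHyperplaneCode

/-! ### Assembly of the four assertions -/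

theorem theorem3 {F : Type*} [Field F] [Fintype F] [DecidableEq F] (q : ℕ)
    (hq : Fintype.card F = q) (n : ℕ) (hn : 1 ≤ n) {N : ℕ} (X : Fin N → Mat F n)
    (hX : Represents (longRootVariety F n) X) (C : Submodule F (Fin N → F))
    (hC : C = projectiveCode F X) :
    -- minimality, and failure of the Ashikhmin–Barg condition
    (2 ≤ n → ¬ (n = 2 ∧ q = 2) → IsMinimalCode C) ∧
    ¬ AshikhminBarg C ∧
    -- the words are those defined by matrices, with the same associated hyperplane
    (∀ c : Fin N → F, c ∈ C ↔ ∃ M : Mat F n, c = codeword X M) ∧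
    (∀ M : Mat F n, wordHyperplane X (codeword X M) = plainHyperplane M) ∧
    -- minimum weight words
    IsLeast (weights C) (q ^ (2 * n - 1) - q ^ (n - 1)) ∧
    (∀ c ∈ C, hammingNorm c = q ^ (2 * n - 1) - q ^ (n - 1) ↔
      IsQuasiSingular (wordHyperplane X c) ∧ ¬ IsSingular (wordHyperplane X c)) ∧
    (∀ c ∈ C, hammingNorm c = q ^ (2 * n - 1) - q ^ (n - 1) → ∀ c' ∈ C,
      (wordHyperplane X c' = wordHyperplane X c ↔ ∃ a : F, a ≠ 0 ∧ c' = a • c)) ∧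
    (∀ H : Set (SegrePoint F n), IsQuasiSingular H ∧ ¬ IsSingular H →
      ∃ c ∈ C, hammingNorm c = q ^ (2 * n - 1) - q ^ (n - 1) ∧ wordHyperplane X c = H) ∧
    (∀ c ∈ C, hammingNorm c = q ^ (2 * n - 1) - q ^ (n - 1) ↔
      ∃ M : Mat F n, M.rank = 1 ∧ M.trace ≠ 0 ∧ c = codeword X M) ∧
    (∀ H : Set (SegrePoint F n), IsQuasiSingular H ∧ ¬ IsSingular H ↔
      ∃ M : Mat F n, M.rank = 1 ∧ M.trace ≠ 0 ∧ H = plainHyperplane M) ∧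
    (∀ M : Mat F n, M.rank = 1 → M.trace ≠ 0 → IsDiagonalizable M) ∧
    -- second lowest weight words
    IsLeast {w | w ∈ weights C ∧ q ^ (2 * n - 1) - q ^ (n - 1) < w} (q ^ (2 * n - 1)) ∧
    (∀ c ∈ C, hammingNorm c = q ^ (2 * n - 1) ↔ IsSingular (wordHyperplane X c)) ∧
    (∀ c ∈ C, hammingNorm c = q ^ (2 * n - 1) → ∀ c' ∈ C,
      (wordHyperplane X c' = wordHyperplane X c ↔ ∃ a : F, a ≠ 0 ∧ c' = a • c)) ∧
    (∀ H : Set (SegrePoint F n), IsSingular H →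
      ∃ c ∈ C, hammingNorm c = q ^ (2 * n - 1) ∧ wordHyperplane X c = H) ∧
    (∀ c ∈ C, hammingNorm c = q ^ (2 * n - 1) ↔
      ∃ M : Mat F n, M.rank = 1 ∧ M.trace = 0 ∧ c = codeword X M) ∧
    (∀ H : Set (SegrePoint F n), IsSingular H ↔ ∃ M : Mat F n, M.rank = 1 ∧ M.trace = 0 ∧ H = plainHyperplane M) ∧
    (∀ M : Mat F n, M.rank = 1 → M.trace = 0 → ¬ IsDiagonalizable M) ∧
    -- maximum weight words (the division is exact)
    IsGreatest (weights C) (q ^ (n - 1) * (q ^ (n + 1) - 1) / (q - 1)) ∧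
    (∀ M : Mat F n, hammingNorm (codeword X M) = q ^ (n - 1) * (q ^ (n + 1) - 1) / (q - 1) ↔
      HasNoEigenvalue M) ∧
    (∀ c ∈ C, IsSpreadType (wordHyperplane X c) →
      hammingNorm c = q ^ (n - 1) * (q ^ (n + 1) - 1) / (q - 1)) ∧
    (∀ H : Set (SegrePoint F n), IsSpreadType H → ArisesFromSegre H → ∃ c ∈ C,
      hammingNorm c = q ^ (n - 1) * (q ^ (n + 1) - 1) / (q - 1) ∧ wordHyperplane X c = H) ∧
    (∀ M : Mat F n, hammingNorm (codeword X M) = q ^ (n - 1) * (q ^ (n + 1) - 1) / (q - 1) →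
      (minpoly F M).natDegree = 2 → IsSpreadType (wordHyperplane X (codeword X M))) := by
  subst hq hC
  have hq2 : 2 ≤ Fintype.card F := Fintype.one_lt_card
  have hlt := minWeight_lt_secondWeight (n := n) hq2
  refine ⟨fun h2 hnq => isMinimalCode_projectiveCode h2 hnq hX, not_ashikhminBarg hn hX,
    fun c => mem_projectiveCode_iff, wordHyperplane_codeword hX, isLeast_weights hn hX, ?_, ?_, ?_,
    ?_, fun H => isQuasiSingular_and_not_isSingular_iff hn,
    fun M => isDiagonalizable_of_rank_eq_one, isLeast_weights_gt hn hX, ?_, ?_, ?_, ?_,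
    fun H => isSingular_iff hn, fun M => not_isDiagonalizable_of_rank_eq_one,
    isGreatest_weights hn hX, fun M => hammingNorm_eq_maxWeight_iff hn hX, ?_, ?_, ?_⟩
  · intro c hc
    obtain ⟨M, rfl⟩ := mem_projectiveCode_iff.1 hc
    rw [wordHyperplane_codeword hX, isQuasiSingular_and_not_isSingular_iff hn]
    constructor
    · intro h
      obtain ⟨M₀, hr, ht, e⟩ := (hammingNorm_eq_minWeight_iff hn hX).1 h
      exact ⟨M₀, hr, ht, by rw [← wordHyperplane_codeword hX, e, wordHyperplane_codeword hX]⟩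
    · rintro ⟨M₀, hr, ht, e⟩
      rw [hammingNorm_eq_of_plainHyperplane_eq hX e, hammingNorm_of_trace_ne_zero hn hX hr ht]
  · intro c hc hw c' hc'
    obtain ⟨M, rfl⟩ := mem_projectiveCode_iff.1 hc
    have h0 : codeword X M ≠ 0 := hammingNorm_pos_iff.1 (hw ▸ minWeight_pos hn hq2)
    obtain ⟨M₀, hr, ht, e⟩ := (hammingNorm_eq_minWeight_iff hn hX).1 hw
    rw [e] at h0 ⊢
    exact wordHyperplane_eq_iff_of_rank_eq_one hX hr h0 hc'
  · intro H hH
    obtain ⟨M, hr, ht, rfl⟩ := (isQuasiSingular_and_not_isSingular_iff hn).1 hH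
    exact ⟨_, mem_projectiveCode_iff.2 ⟨M, rfl⟩, hammingNorm_of_trace_ne_zero hn hX hr ht,
      wordHyperplane_codeword hX M⟩
  · intro c hc
    obtain ⟨M, rfl⟩ := mem_projectiveCode_iff.1 hc
    exact hammingNorm_eq_minWeight_iff hn hX
  · intro c hc
    obtain ⟨M, rfl⟩ := mem_projectiveCode_iff.1 hc
    rw [wordHyperplane_codeword hX, isSingular_iff hn]
    constructor
    · intro h
      obtain ⟨M₀, hr, ht, e⟩ := (hammingNorm_eq_secondWeight_iff hn hX).1 h
      exact ⟨M₀, hr, ht, by rw [← wordHyperplane_codeword hX, e, wordHyperplane_codeword hX]⟩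
    · rintro ⟨M₀, hr, ht, e⟩
      rw [hammingNorm_eq_of_plainHyperplane_eq hX e, hammingNorm_of_trace_eq_zero hn hX hr ht]
  · intro c hc hw c' hc'
    obtain ⟨M, rfl⟩ := mem_projectiveCode_iff.1 hc
    have h0 : codeword X M ≠ 0 := hammingNorm_pos_iff.1 (by omega)
    obtain ⟨M₀, hr, ht, e⟩ := (hammingNorm_eq_secondWeight_iff hn hX).1 hw
    rw [e] at h0 ⊢
    exact wordHyperplane_eq_iff_of_rank_eq_one hX hr h0 hc'
  · intro H hH
    obtain ⟨M, hr, ht, rfl⟩ := (isSingular_iff hn).1 hH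
    exact ⟨_, mem_projectiveCode_iff.2 ⟨M, rfl⟩, hammingNorm_of_trace_eq_zero hn hX hr ht,
      wordHyperplane_codeword hX M⟩
  · intro c hc
    obtain ⟨M, rfl⟩ := mem_projectiveCode_iff.1 hc
    exact hammingNorm_eq_secondWeight_iff hn hX
  · intro c hc h
    obtain ⟨M, rfl⟩ := mem_projectiveCode_iff.1 hc
    rw [wordHyperplane_codeword hX] at h
    exact (hammingNorm_eq_maxWeight_iff hn hX).2 (hasNoEigenvalue_of_isSpreadType h)
  · intro H hH hS
    obtain ⟨M, rfl⟩ := hS.exists_eq_plainHyperplane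
    exact ⟨_, mem_projectiveCode_iff.2 ⟨M, rfl⟩, (hammingNorm_eq_maxWeight_iff hn hX).2
      (hasNoEigenvalue_of_isSpreadType hH), wordHyperplane_codeword hX M⟩
  · intro M hM hd
    obtain ⟨a, b, e⟩ := exists_mul_self_eq_of_natDegree_minpoly hd
    rw [wordHyperplane_codeword hX]
    exact isSpreadType_of_mul_self_eq e ((hammingNorm_eq_maxWeight_iff hn hX).1 hM)
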